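/- Let $d\ge 1$, let $D_d\subset\mathbb{R}^d$ be bounded, let $\mathcal{I}_d\subset (D_d)^{\mathbb{Z}_-}$ be a set of input sequences $\mathbf z=(\mathbf z_t)_{t\in\mathbb{Z}_-}$, $\mathbb{Z}_-=\{0,-1,-2,\dots\}$, with the $\sigma$-algebra induced by the product Borel $\sigma$-algebra, and let $\sigma_2\colon\mathbb{R}\to\mathbb{R}$ be either $\sigma_2(x)=\max(x,0)$ or a bounded, Lipschitz-continuous, non-constant function. For every $N\ge 1$ let $A_N\in\mathbb{R}^{N\times N}$, $\mathbf B_N\in\mathbb{R}^N$, $C_N\in\mathbb{R}^{N\times d}$ be the parameters of a linear echo state network (ESN) $$\mathbf x_t=A_N\mathbf x_{t-1}+C_N\mathbf z_t+\mathbf B_N,\qquad t\in\mathbb{Z}_-,$$ and let $K_N\in\mathbb{R}^{N\times N}$ consist of the first $N$ columns of $(C_N\,|\,A_NC_N\,|\,A_N^2C_N\,|\cdots)$. Write $\|\cdot\|$ for Euclidean norms and $|||\cdot|||$ for the induced operator norms. Assume that there are $\bar c>0$ and $0<\underline l<\bar l<1$ such that for every $N\ge1$ the matrix $K_N$ is invertible,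 $\underline l<|||A_N|||<\bar l$, $\|\mathbf B_N\|\le\bar c$, $|||C_N|||\le\bar c$ and $|||K_N^{-\top}\Lambda_N|||\le\bar c$, where $\Lambda_N\in\mathbb{R}^{N\times N}$ is the diagonal matrix with entries $(\Lambda_N)_{d(k-1)+j,\,d(k-1)+j}=\underline l^{\,k-1}$ for $k\ge1$, $1\le j\le d$, $d(k-1)+j\le N$. For every $N\ge1$ let $\nu_0^N$ be a prescribed probability measure on the space $\mathcal{X}^N=\mathbb{R}\times\mathbb{R}^N\times\mathbb{R}^d\times\mathbb{R}$ of hidden weights $(w,\mathbf a,\mathbf c,b)$, with first moments bounded uniformly in $N$: $\sup_{N}\int_{\mathcal{X}^N}\|x\|\,\nu_0^N(dx)<\infty$. Let $\gamma$ be a probability measure on $\mathcal{I}_d$, let $H\in L^2(\mathcal{I}_d,\gamma)$ be real-valued and let $\varepsilon>0$. Then there is $N_0$ such that for every $N\ge N_0$ the following holds. For each $\mathbf z\in\mathcal{I}_d$ the ESN has a unique bounded solution $(\mathbf x_t(\mathbf z))_{t\in\mathbb{Z}_-}$, and there are a probability measure $\nu$ on $\mathcal{X}^N$ with $\mathcal{W}_1(\nu_0^N,\nu)<\varepsilon$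 ($\mathcal{W}_1$ being the 1-Wasserstein distance for the Euclidean distance on $\mathcal{X}^N$) and a measurable map $f\colon(\mathcal{X}^N)^N\to\mathbb{R}^N$ such that, if $(w^{(i)},\mathbf a^{(i)},\mathbf c^{(i)},b_i)$, $i=1,\dots,N$, are i.i.d. with law $\nu$ and $\mathbf W=f\big((w^{(i)},\mathbf a^{(i)},\mathbf c^{(i)},b_i)_{i=1,\dots,N}\big)$, the ESN-ELM $$\widehat H(\mathbf z)=\sum_{i=1}^N W_i\,\sigma_2\big(\mathbf a^{(i)}\cdot\mathbf x_{-1}(\mathbf z)+\mathbf c^{(i)}\cdot\mathbf z_0+b_i\big)$$ satisfies $$\Big(\int_{\mathcal{I}_d}\mathbb{E}\big[|H(\mathbf z)-\widehat H(\mathbf z)|^2\big]\,\gamma(d\mathbf z)\Big)^{1/2}<\varepsilon.$$ -/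

import Mathlib

open MeasureTheory
open scoped ENNReal NNReal Matrix.Norms.L2Operator

noncomputable section

namespace ESN

/-- `ℝⁿ` with the Euclidean norm. -/
abbrev Vec (n : ℕ) : Type := EuclideanSpace ℝ (Fin n)

/-- Semi-infinite sequences `(u_t)` indexed by the non-positive integers `t = 0, -1, -2, …`;
the entry `u k` stands for `u_{-k}`. -/
abbrev PastSeq (n : ℕ) : Type := ℕ → Vec n

/-- The space `ℝ × ℝᴺ × ℝᵈ × ℝ` of hidden weights `(w, a, c, b)`. -/
abbrev Weights (N d : ℕ) : Type := ℝ × Vec N × Vec d × ℝ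

/-- The Euclidean norm on `ℝ × ℝᴺ × ℝᵈ × ℝ` (the norm that Lean puts on a product is the
maximum norm, which is not used here). -/
def weightNorm {N d : ℕ} (x : Weights N d) : ℝ :=
  √(x.1 ^ 2 + ‖x.2.1‖ ^ 2 + ‖x.2.2.1‖ ^ 2 + x.2.2.2 ^ 2)

/-- First absolute moment. -/
def firstMoment {N d : ℕ} (ν : Measure (Weights N d)) : ℝ≥0∞ :=
  ∫⁻ x, ENNReal.ofReal (weightNorm x) ∂ν

/-- `π` is a coupling of `μ` and `ν`. -/
def IsCoupling {N d : ℕ} (π : Measure (Weights N d × Weights N d))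
    (μ ν : Measure (Weights N d)) : Prop :=
  π.map Prod.fst = μ ∧ π.map Prod.snd = ν

/-- The 1-Wasserstein distance with respect to the Euclidean distance: the infimum of the
transport cost over all couplings. -/
def wasserstein1 {N d : ℕ} (μ ν : Measure (Weights N d)) : ℝ≥0∞ :=
  ⨅ (π : Measure (Weights N d × Weights N d)) (_ : IsCoupling π μ ν),
    ∫⁻ p, ENNReal.ofReal (weightNorm (p.1 - p.2)) ∂π

/-- `x` is a bounded solution of `x_t = σ₁(A x_{t-1} + C z_t + B)`, `t = 0, -1, -2, …`, where `σ₁`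
acts componentwise. -/
def IsBoundedSolution {N d : ℕ} (σ₁ : ℝ → ℝ) (A : Matrix (Fin N) (Fin N) ℝ) (B : Vec N)
    (C : Matrix (Fin N) (Fin d) ℝ) (z : PastSeq d) (x : PastSeq N) : Prop :=
  (∀ k i, x k i = σ₁ (A.mulVec (x (k + 1)) i + C.mulVec (z k) i + B i)) ∧
    ∃ R : ℝ, ∀ k, ‖x k‖ ≤ R

/-- The state sequence of the echo state network with input `z`: the bounded solution of the state
equation (an unspecified sequence if there is none). -/
def state {N d : ℕ} (σ₁ : ℝ → ℝ) (A : Matrix (Fin N) (Fin N) ℝ) (B : Vec N)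
    (C : Matrix (Fin N) (Fin d) ℝ) (z : PastSeq d) : PastSeq N :=
  Classical.epsilon (IsBoundedSolution σ₁ A B C z)

/-- The ESN-ELM with readout `W` and hidden weights `ξ i = (w⁽ⁱ⁾, a⁽ⁱ⁾, c⁽ⁱ⁾, b_i)`:
`z ↦ ∑ i, W_i σ₂(a⁽ⁱ⁾ · x_{-1}(z) + c⁽ⁱ⁾ · z_0 + b_i)`. -/
def esnElm {N d : ℕ} (σ₁ σ₂ : ℝ → ℝ) (A : Matrix (Fin N) (Fin N) ℝ) (B : Vec N)
    (C : Matrix (Fin N) (Fin d) ℝ) (W : Fin N → ℝ) (ξ : Fin N → Weights N d)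
    (z : PastSeq d) : ℝ :=
  ∑ i, W i * σ₂ (inner ℝ (ξ i).2.1 (state σ₁ A B C z 1) + inner ℝ (ξ i).2.2.1 (z 0) + (ξ i).2.2.2)

/-- The controllability matrix: the first `N` columns of `(C | A C | A² C | ⋯)`. With columns
numbered from `0`, column `d k + j` (`0 ≤ j < d`) is column `j` of `Aᵏ C`. -/
def controllability {N d : ℕ} [NeZero d] (A : Matrix (Fin N) (Fin N) ℝ)
    (C : Matrix (Fin N) (Fin d) ℝ) : Matrix (Fin N) (Fin N) ℝ :=
  Matrix.of fun i m => (A ^ ((m : ℕ) / d) * C) i (Fin.ofNat d (m : ℕ))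

/-- The diagonal matrix whose entry at position `d k + j` (`0 ≤ j < d`, numbered from `0`)
is `lᵏ`. -/
def decay (N d : ℕ) (l : ℝ) : Matrix (Fin N) (Fin N) ℝ :=
  Matrix.diagonal fun m => l ^ ((m : ℕ) / d)

end ESN

end

/-!
Call `z ↦ σ₂ (∑ j, ⟪θ j, z j⟫ + b)`, with finitely supported `θ`, a neuron of the past inputs.

These neurons span a dense subspace of `L²(γ)`. Let `φ` be orthogonal to all of them, and let `t` be
a finite linear form in the inputs, which is bounded. Then `∫ σ₂ (s t + b) φ dγ = 0` for all `s` and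
`b`, and the same holds for `x ↦ σ₂ (x + h) - σ₂ x`, which is bounded and, for a suitable `h`, not
constant, and for a mollification `g` of it. The `n`-th derivative in `s` at `s = 0` gives
`g⁽ⁿ⁾(b) ∫ tⁿ φ dγ = 0`, and `g⁽ⁿ⁾` is not identically zero because a bounded nonconstant function
is not a polynomial. So all moments `∫ tⁿ φ dγ` vanish, hence so do the Fourier transforms of all
finite-dimensional projections of `φ γ`, and `φ = 0`.

The state of the network determines the past inputs up to a small error. Unrolling the state
equation, `x_{-1} = ∑ Aᵏ (C z_{-1-k} + B)`, so the vector `a` with `Kᵀ a = (θ₁, θ₂, …)` reads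
`∑ ⟪θ j, z j⟫` off `x_{-1}` up to a constant, which is absorbed in the bias, and an error of order
`l₁ ^ (N / d)`. Since `K⁻ᵀ Λ` is bounded uniformly in `N`, so is `a`. Hence `H` is approximated by a
combination of a fixed number of neurons of the network whose hidden weights stay bounded as
`N → ∞`.

Moving a small fraction `δ` of the mass of `ν₀` to these hidden weights changes it by `O(δ)` in the
Wasserstein distance. With probability tending to `1`, an i.i.d. sample of size `N` from the
resulting law hits all of them; the readout then places the coefficients of the combination on
neurons that hit, and it is zero otherwise.
-/

noncomputable section

namespace ESN

open Filter Topology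
open scoped ContDiff Convolution

section RidgeFunctions

theorem derivative_surjective {K : Type*} [Field K] [CharZero K] :
    Function.Surjective (Polynomial.derivative : Polynomial K →ₗ[K] Polynomial K) := by
  intro p
  induction p using Polynomial.induction_on' with
  | add p q hp hq =>
    obtain ⟨p', rfl⟩ := hp
    obtain ⟨q', rfl⟩ := hq
    exact ⟨p' + q', map_add _ _ _⟩
  | monomial n a =>
    refine ⟨Polynomial.monomial (n + 1) (a / (n + 1 : ℕ)), ?_⟩
    rw [Polynomial.derivative_monomial, Nat.add_sub_cancel,
      div_mul_cancel₀ _ (Nat.cast_ne_zero.2 n.succ_ne_zero)]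

theorem exists_polynomial_of_iteratedDeriv_eq_zero {𝕜 : Type*} [RCLike 𝕜] {n : ℕ} {g : 𝕜 → 𝕜}
    (hg : ContDiff 𝕜 n g) (h : ∀ x, iteratedDeriv n g x = 0) :
    ∃ p : Polynomial 𝕜, ∀ x, g x = p.eval x := by
  induction n generalizing g with
  | zero => exact ⟨0, by simpa using h⟩
  | succ n ih =>
    rw [Nat.cast_succ, contDiff_succ_iff_deriv] at hg
    obtain ⟨hd, -, hg'⟩ := hg
    obtain ⟨p, hp⟩ := ih hg' fun x => by rw [← iteratedDeriv_succ', h x]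
    obtain ⟨q, rfl⟩ := derivative_surjective p
    have hconst := is_const_of_deriv_eq_zero (f := fun x => g x - q.eval x)
      (hd.sub q.differentiable) fun x => by
        rw [deriv_fun_sub (hd x) q.differentiableAt, hp x, Polynomial.deriv, sub_self]
    refine ⟨q + Polynomial.C (g 0 - q.eval 0), fun x => ?_⟩
    rw [Polynomial.eval_add, Polynomial.eval_C, ← hconst x 0, add_sub_cancel]

theorem exists_iteratedDeriv_ne_zero {n : ℕ} {g : ℝ → ℝ} (hg : ContDiff ℝ n g) {K : ℝ}
    (hK : ∀ x, |g x| ≤ K) {x y : ℝ} (hxy : g x ≠ g y) : ∃ b, iteratedDeriv n g b ≠ 0 := by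
  by_contra! h
  obtain ⟨p, hp⟩ := exists_polynomial_of_iteratedDeriv_eq_zero hg h
  have hdeg : p.degree ≤ 0 := by
    rw [← Polynomial.isBoundedUnder_abs_atTop_iff]
    exact isBoundedUnder_of ⟨K, fun x => by simpa only [hp] using hK x⟩
  apply hxy
  rw [hp, hp, Polynomial.eq_C_of_degree_le_zero hdeg, Polynomial.eval_C, Polynomial.eval_C]

theorem exists_normed_convolution_ne {σ : ℝ → ℝ} (hσ : Continuous σ) {x y : ℝ} (hxy : σ x ≠ σ y) :
    ∃ ρ : ContDiffBump (0 : ℝ), (ρ.normed volume ⋆ σ) x ≠ (ρ.normed volume ⋆ σ) y := by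
  let ρ (n : ℕ) : ContDiffBump (0 : ℝ) :=
    ⟨1 / (n + 1) / 2, 1 / (n + 1), by positivity, half_lt_self (by positivity)⟩
  have hρ : Tendsto (fun n => (ρ n).rOut) atTop (𝓝 0) := tendsto_one_div_add_atTop_nhds_zero_nat
  have hlim (u : ℝ) : Tendsto (fun n => ((ρ n).normed volume ⋆ σ) u) atTop (𝓝 (σ u)) :=
    ContDiffBump.convolution_tendsto_right_of_continuous hρ hσ u
  by_contra! heq
  exact hxy (tendsto_nhds_unique (hlim x) (by simpa only [heq] using hlim y))

theorem abs_normed_convolution_le (ρ : ContDiffBump (0 : ℝ)) {σ : ℝ → ℝ} {K : ℝ}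
    (hK : ∀ x, |σ x| ≤ K) (x : ℝ) : |(ρ.normed volume ⋆ σ) x| ≤ K := by
  calc ‖∫ y, ρ.normed volume y * σ (x - y)‖
      ≤ ∫ y, ρ.normed volume y * K := by
        refine norm_integral_le_of_norm_le (ρ.integrable_normed.mul_const K)
          (Eventually.of_forall fun y => ?_)
        rw [norm_mul, Real.norm_of_nonneg (ρ.nonneg_normed y)]
        exact mul_le_mul_of_nonneg_left (hK _) (ρ.nonneg_normed y)
    _ = K := by rw [integral_mul_const, ρ.integral_normed, one_mul]

variable {Ω : Type*} [MeasurableSpace Ω] {γ : Measure Ω} {φ t : Ω → ℝ} {S : ℝ}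

theorem exists_abs_comp_affine_le {g : ℝ → ℝ} (hg : Continuous g) (S b s : ℝ) :
    ∃ K, ∀ s' ∈ Metric.ball s 1, ∀ u, |u| ≤ S → |g (s' * u + b)| ≤ K := by
  obtain ⟨K, hK⟩ := (isCompact_closedBall (0 : ℝ)
    ((|s| + 1) * S + |b|)).exists_bound_of_continuousOn hg.continuousOn
  refine ⟨K, fun s' hs' u hu => hK _ ?_⟩
  have hs : |s'| ≤ |s| + 1 := by
    have h1 : |s' - s| < 1 := hs'
    linarith [abs_sub_abs_le_abs_sub s' s]
  rw [mem_closedBall_zero_iff, Real.norm_eq_abs]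
  calc |s' * u + b| ≤ |s'| * |u| + |b| := by rw [← abs_mul]; exact abs_add_le _ _
    _ ≤ (|s| + 1) * S + |b| := by gcongr

theorem integrable_comp_affine_mul (hφ : Integrable φ γ) (ht : AEStronglyMeasurable t γ)
    (hS : ∀ᵐ z ∂γ, |t z| ≤ S) {g : ℝ → ℝ} (hg : Continuous g) (s b : ℝ) :
    Integrable (fun z => g (s * t z + b) * φ z) γ := by
  obtain ⟨K, hK⟩ := exists_abs_comp_affine_le hg S b s
  refine hφ.bdd_mul (c := K)
    (hg.comp_aestronglyMeasurable ((ht.const_mul s).add aestronglyMeasurable_const)) ?_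
  filter_upwards [hS] with z hz using hK s (Metric.mem_ball_self one_pos) _ hz

theorem integral_deriv_comp_affine_mul_eq_zero (hφ : Integrable φ γ)
    (ht : AEStronglyMeasurable t γ) (hS : ∀ᵐ z ∂γ, |t z| ≤ S) {g : ℝ → ℝ} (hg : ContDiff ℝ 1 g)
    (h : ∀ s b, ∫ z, g (s * t z + b) * φ z ∂γ = 0) (s b : ℝ) :
    ∫ z, deriv g (s * t z + b) * (t z * φ z) ∂γ = 0 := by
  have htφ : Integrable (fun z => t z * φ z) γ := hφ.bdd_mul ht hS
  have hg' : Continuous (deriv g) := hg.continuous_deriv le_rfl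
  obtain ⟨K, hK⟩ := exists_abs_comp_affine_le hg' S b s
  have hderiv := (hasDerivAt_integral_of_dominated_loc_of_deriv_le (μ := γ)
    (F := fun s z => g (s * t z + b) * φ z)
    (F' := fun s z => deriv g (s * t z + b) * (t z * φ z)) (bound := fun z => K * ‖t z * φ z‖)
    (Metric.ball_mem_nhds s one_pos)
    (Eventually.of_forall fun s' =>
      (integrable_comp_affine_mul hφ ht hS hg.continuous s' b).aestronglyMeasurable)
    (integrable_comp_affine_mul hφ ht hS hg.continuous s b)
    (integrable_comp_affine_mul htφ ht hS hg' s b).aestronglyMeasurable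
    (by
      filter_upwards [hS] with z hz s' hs'
      rw [norm_mul]
      exact mul_le_mul_of_nonneg_right (hK s' hs' _ hz) (norm_nonneg _))
    (htφ.norm.const_mul K)
    (Eventually.of_forall fun z s' _ => by
      have haffine : HasDerivAt (fun s' => s' * t z + b) (t z) s' :=
        (hasDerivAt_mul_const (t z)).add_const b
      have hg_at := (hg.differentiable one_ne_zero (s' * t z + b)).hasDerivAt
      exact ((hg_at.comp s' haffine).mul_const (φ z)).congr_deriv (mul_assoc _ _ _))).2
  simp only [h] at hderiv
  exact hderiv.unique (hasDerivAt_const s 0)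

theorem integral_iteratedDeriv_comp_affine_mul_eq_zero (ht : AEStronglyMeasurable t γ)
    (hS : ∀ᵐ z ∂γ, |t z| ≤ S) (n : ℕ) {g : ℝ → ℝ} (hg : ContDiff ℝ n g) (hφ : Integrable φ γ)
    (h : ∀ s b, ∫ z, g (s * t z + b) * φ z ∂γ = 0) (s b : ℝ) :
    ∫ z, iteratedDeriv n g (s * t z + b) * (t z ^ n * φ z) ∂γ = 0 := by
  induction n generalizing g φ with
  | zero => simpa using h s b
  | succ n ih =>
    have hg1 : ContDiff ℝ 1 g := hg.of_le (by exact_mod_cast Nat.le_add_left 1 n)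
    rw [Nat.cast_succ, contDiff_succ_iff_deriv] at hg
    simpa only [iteratedDeriv_succ', pow_succ, mul_assoc] using
      ih hg.2.2 (hφ.bdd_mul ht hS) (integral_deriv_comp_affine_mul_eq_zero hφ ht hS hg1 h)

theorem integral_convolution_comp_affine_mul_eq_zero [SFinite γ] (hφ : Integrable φ γ)
    (ht : AEStronglyMeasurable t γ) {σ ψ : ℝ → ℝ} (hψ : Integrable ψ) (hσ : Continuous σ) {K : ℝ}
    (hK : ∀ x, |σ x| ≤ K) (h : ∀ s b, ∫ z, σ (s * t z + b) * φ z ∂γ = 0) (s b : ℝ) :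
    ∫ z, (ψ ⋆ σ) (s * t z + b) * φ z ∂γ = 0 := by
  have hint : Integrable (fun p : Ω × ℝ => σ (s * t p.1 + b - p.2) * (φ p.1 * ψ p.2))
      (γ.prod volume) := by
    refine (hφ.mul_prod hψ).bdd_mul (c := K) (hσ.comp_aestronglyMeasurable ?_)
      (Eventually.of_forall fun p => hK _)
    exact ((ht.comp_fst.const_mul s).add aestronglyMeasurable_const).sub
      measurable_snd.aestronglyMeasurable
  calc ∫ z, (∫ y, ψ y * σ (s * t z + b - y)) * φ z ∂γ
      = ∫ z, (∫ y, σ (s * t z + b - y) * (φ z * ψ y)) ∂γ := by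
        simp_rw [← integral_mul_const]
        congr! 4
        ring
    _ = ∫ y, (∫ z, σ (s * t z + b - y) * (φ z * ψ y) ∂γ) := integral_integral_swap hint
    _ = ∫ y, (∫ z, σ (s * t z + (b - y)) * φ z ∂γ) * ψ y := by
        simp_rw [← integral_mul_const, mul_assoc, add_sub_assoc]
    _ = 0 := by simp only [h, zero_mul, integral_zero]

theorem integral_pow_mul_eq_zero [SFinite γ] (hφ : Integrable φ γ) (ht : AEStronglyMeasurable t γ)
    (hS : ∀ᵐ z ∂γ, |t z| ≤ S) {σ : ℝ → ℝ} (hσ : Continuous σ) {K : ℝ} (hK : ∀ x, |σ x| ≤ K)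
    {x y : ℝ} (hxy : σ x ≠ σ y) (h : ∀ s b, ∫ z, σ (s * t z + b) * φ z ∂γ = 0) (n : ℕ) :
    ∫ z, t z ^ n * φ z ∂γ = 0 := by
  obtain ⟨ρ, hρ⟩ := exists_normed_convolution_ne hσ hxy
  have hsmooth : ContDiff ℝ n (ρ.normed volume ⋆ σ) :=
    ρ.hasCompactSupport_normed.contDiff_convolution_left _ ρ.contDiff_normed hσ.locallyIntegrable
  obtain ⟨b, hb⟩ := exists_iteratedDeriv_ne_zero hsmooth (abs_normed_convolution_le ρ hK) hρ
  have hzero := integral_iteratedDeriv_comp_affine_mul_eq_zero ht hS n hsmooth hφ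
    (integral_convolution_comp_affine_mul_eq_zero hφ ht ρ.integrable_normed hσ hK h) 0 b
  simp only [zero_mul, zero_add, integral_const_mul] at hzero
  exact (mul_eq_zero.1 hzero).resolve_left hb

theorem hasSum_cexp_mul_I_mul (u v : ℝ) :
    HasSum (fun n : ℕ => Complex.I ^ n / n.factorial * ((u ^ n * v : ℝ) : ℂ))
      (Complex.exp (u * Complex.I) * v) := by
  have hexp := (NormedSpace.expSeries_div_hasSum_exp (u * Complex.I)).mul_right (v : ℂ)
  rw [← Complex.exp_eq_exp_ℂ] at hexp
  refine hexp.congr_fun fun n => ?_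
  push_cast
  ring

theorem integral_cexp_mul_eq_zero_of_integral_pow_mul_eq_zero (hφ : Integrable φ γ)
    (ht : AEStronglyMeasurable t γ) (hS : ∀ᵐ z ∂γ, |t z| ≤ S)
    (h : ∀ n : ℕ, ∫ z, t z ^ n * φ z ∂γ = 0) :
    ∫ z, Complex.exp (t z * Complex.I) * φ z ∂γ = 0 := by
  have hterm (n : ℕ) : ∀ᵐ z ∂γ, ‖Complex.I ^ n / n.factorial * ((t z ^ n * φ z : ℝ) : ℂ)‖ ≤
      S ^ n / n.factorial * |φ z| := by
    filter_upwards [hS] with z hz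
    simp only [norm_mul, norm_div, norm_pow, Complex.norm_I, one_pow, Complex.norm_real,
      Complex.norm_natCast, Real.norm_eq_abs]
    rw [div_mul_eq_mul_div, div_mul_eq_mul_div, one_mul]
    gcongr
  have hsum := hasSum_integral_of_dominated_convergence (μ := γ)
    (F := fun (n : ℕ) z => Complex.I ^ n / n.factorial * ((t z ^ n * φ z : ℝ) : ℂ))
    (f := fun z => Complex.exp (t z * Complex.I) * φ z)
    (fun n z => S ^ n / n.factorial * |φ z|)
    (fun n => (Complex.continuous_ofReal.comp_aestronglyMeasurable
      ((ht.pow n).mul hφ.1)).const_mul _) hterm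
    (Eventually.of_forall fun z => (Real.summable_pow_div_factorial S).mul_right _)
    (by simp_rw [tsum_mul_right]; exact hφ.abs.const_mul _)
    (Eventually.of_forall fun z => hasSum_cexp_mul_I_mul (t z) (φ z))
  simp only [integral_const_mul, integral_complex_ofReal, h, Complex.ofReal_zero,
    mul_zero] at hsum
  exact hsum.unique hasSum_zero

theorem exists_sub_ne_sub_of_not_affine {σ : ℝ → ℝ} (hσ : Continuous σ)
    (hσ' : ¬ ∃ a b, ∀ x, σ x = a * x + b) : ∃ h x y, σ (x + h) - σ x ≠ σ (y + h) - σ y := by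
  by_contra! hconst
  let f : ℝ →+ ℝ := AddMonoidHom.mk' (fun x => σ x - σ 0) fun x h => by
    linear_combination hconst h x 0 + congrArg σ (zero_add h)
  refine hσ' ⟨f 1, σ 0, fun x => ?_⟩
  have hlin := map_real_smul f (hσ.sub continuous_const) x 1
  simp only [smul_eq_mul, mul_one] at hlin
  rw [mul_comm, ← hlin]
  exact (sub_add_cancel _ _).symm

theorem integral_cexp_mul_eq_zero [SFinite γ] (hφ : Integrable φ γ) (ht : AEStronglyMeasurable t γ)
    (hS : ∀ᵐ z ∂γ, |t z| ≤ S) {σ : ℝ → ℝ} {L : ℝ≥0} (hσ : LipschitzWith L σ)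
    (hσ' : ¬ ∃ a b, ∀ x, σ x = a * x + b) (h : ∀ s b, ∫ z, σ (s * t z + b) * φ z ∂γ = 0) :
    ∫ z, Complex.exp (t z * Complex.I) * φ z ∂γ = 0 := by
  have hc := hσ.continuous
  obtain ⟨r, x, y, hxy⟩ := exists_sub_ne_sub_of_not_affine hc hσ'
  have hbound (u : ℝ) : |σ (u + r) - σ u| ≤ L * |r| := by
    simpa [Real.dist_eq] using hσ.dist_le_mul (u + r) u
  refine integral_cexp_mul_eq_zero_of_integral_pow_mul_eq_zero hφ ht hS
    (integral_pow_mul_eq_zero hφ ht hS (σ := fun u => σ (u + r) - σ u) (by fun_prop) hbound hxy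
      fun s b => ?_)
  have hint := integrable_comp_affine_mul hφ ht hS hc s
  simp_rw [sub_mul, add_assoc]
  rw [integral_sub (hint _) (hint _), h, h, sub_zero]

end RidgeFunctions

section SquareIntegrable

variable {Ω : Type*} [MeasurableSpace Ω] {γ : Measure Ω}

theorem ofReal_toReal_sub_ofReal_neg_toReal (x : ℝ) :
    (ENNReal.ofReal x).toReal - (ENNReal.ofReal (-x)).toReal = x := by
  rw [ENNReal.toReal_ofReal', ENNReal.toReal_ofReal', max_zero_sub_max_neg_zero_eq_self]

theorem integral_withDensity_ofReal_sub {φ : Ω → ℝ} (hφ : Integrable φ γ) {f : Ω → ℂ}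
    (hf : AEStronglyMeasurable f γ) {K : ℝ} (hK : ∀ z, ‖f z‖ ≤ K) :
    ∫ z, f z ∂γ.withDensity (fun z => ENNReal.ofReal (φ z)) -
      ∫ z, f z ∂γ.withDensity (fun z => ENNReal.ofReal (-φ z)) = ∫ z, f z * φ z ∂γ := by
  have hint {ψ : Ω → ℝ} (hψ : Integrable ψ γ) :
      Integrable (fun z => (ENNReal.ofReal (ψ z)).toReal • f z) γ := by
    simp only [ENNReal.toReal_ofReal']
    exact hψ.pos_part.smul_bdd K hf (Eventually.of_forall hK)
  rw [integral_withDensity_eq_integral_toReal_smul₀ hφ.1.aemeasurable.ennreal_ofReal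
      (Eventually.of_forall fun _ => ENNReal.ofReal_lt_top),
    integral_withDensity_eq_integral_toReal_smul₀ hφ.1.aemeasurable.fun_neg.ennreal_ofReal
      (Eventually.of_forall fun _ => ENNReal.ofReal_lt_top),
    ← integral_sub (hint hφ) (hint hφ.fun_neg)]
  refine integral_congr_ae (Eventually.of_forall fun z => ?_)
  dsimp only
  rw [← sub_smul, ofReal_toReal_sub_ofReal_neg_toReal, Complex.real_smul, mul_comm]

theorem ae_eq_zero_of_withDensity_ofReal_eq {φ : Ω → ℝ} (hφ : Integrable φ γ)
    (h : γ.withDensity (fun z => ENNReal.ofReal (φ z)) =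
      γ.withDensity fun z => ENNReal.ofReal (-φ z)) : φ =ᵐ[γ] 0 := by
  have hae := (withDensity_eq_iff hφ.1.aemeasurable.ennreal_ofReal
    hφ.1.aemeasurable.fun_neg.ennreal_ofReal hφ.lintegral_lt_top.ne).1 h
  filter_upwards [hae] with z hz
  have hsub := ofReal_toReal_sub_ofReal_neg_toReal (φ z)
  rwa [hz, sub_self, eq_comm] at hsub

theorem measure_ext_of_map_subtype_val_eq {s : Set Ω} {μ ν : Measure s}
    (h : μ.map Subtype.val = ν.map Subtype.val) : μ = ν := by
  ext _ ⟨t, ht, rfl⟩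
  rw [← Measure.map_apply measurable_subtype_coe ht, h, Measure.map_apply measurable_subtype_coe ht]

variable {ι : Type*} {u : ι → Ω → ℝ}

theorem topologicalClosure_span_toLp_eq_top (hu : ∀ i, MemLp (u i) 2 γ)
    (htotal : ∀ φ, MemLp φ 2 γ → (∀ i, ∫ z, u i z * φ z ∂γ = 0) → φ =ᵐ[γ] 0) :
    (Submodule.span ℝ (Set.range fun i => (hu i).toLp)).topologicalClosure = ⊤ := by
  rw [Submodule.topologicalClosure_eq_top_iff, Submodule.eq_bot_iff]
  intro φ hφ
  refine Lp.ext ((htotal φ (Lp.memLp φ) fun i => ?_).trans (Lp.coeFn_zero _ _ _).symm)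
  have horth := (Submodule.mem_orthogonal _ _).1 hφ (hu i).toLp (Submodule.subset_span ⟨i, rfl⟩)
  rw [L2.inner_def] at horth
  rw [← horth]
  refine integral_congr_ae ?_
  filter_upwards [(hu i).coeFn_toLp] with z hz
  rw [hz, RCLike.inner_apply, conj_trivial, mul_comm]

theorem exists_eLpNorm_sub_sum_lt_of_total [Nonempty ι] (hu : ∀ i, MemLp (u i) 2 γ)
    (htotal : ∀ φ, MemLp φ 2 γ → (∀ i, ∫ z, u i z * φ z ∂γ = 0) → φ =ᵐ[γ] 0)
    {H : Ω → ℝ} (hH : MemLp H 2 γ) {e : ℝ≥0∞} (he : e ≠ 0) :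
    ∃ (n : ℕ) (i : Fin (n + 1) → ι) (v : Fin (n + 1) → ℝ),
      eLpNorm (fun z => H z - ∑ j, v j * u (i j) z) 2 γ < e := by
  have hclosure : hH.toLp ∈
      (Submodule.span ℝ (Set.range fun i => (hu i).toLp)).topologicalClosure :=
    topologicalClosure_span_toLp_eq_top hu htotal ▸ Submodule.mem_top
  obtain ⟨G, hG, hHG⟩ := EMetric.mem_closure_iff.1 hclosure e (pos_iff_ne_zero.2 he)
  obtain ⟨n, v, g, rfl⟩ := Submodule.mem_span_set'.1 hG
  choose i hi using fun j => (g j).2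
  refine ⟨n, Fin.cons (Classical.arbitrary ι) i, Fin.cons 0 v, ?_⟩
  rw [Lp.edist_def] at hHG
  refine (eLpNorm_congr_ae ?_).trans_lt hHG
  have hG_apply : ∀ᵐ z ∂γ, ∀ j, (v j • (g j : Lp ℝ 2 γ)) z = v j * u (i j) z := by
    refine eventually_all.2 fun j => ?_
    rw [← hi j]
    filter_upwards [Lp.coeFn_smul (v j) (hu (i j)).toLp, (hu (i j)).coeFn_toLp] with z hsmul hz
    rw [hsmul, Pi.smul_apply, smul_eq_mul, hz]
  filter_upwards [hH.coeFn_toLp, Lp.coeFn_fun_finsetSum Finset.univ fun j => v j • (g j : Lp ℝ 2 γ),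
    hG_apply] with z hHz hsum hGz
  rw [Pi.sub_apply, hHz, hsum, Fin.sum_univ_succ]
  simp only [Fin.cons_zero, Fin.cons_succ, zero_mul, zero_add, hGz]

end SquareIntegrable

section PastNeurons

variable {d : ℕ}

/-- The linear functional `z ↦ ∑ k, θ_k · z_{-k}` of finitely many past inputs. -/
def pastForm (θ : ℕ →₀ Vec d) (z : PastSeq d) : ℝ :=
  θ.sum fun k u => inner ℝ u (z k)

theorem continuous_pastForm (θ : ℕ →₀ Vec d) : Continuous (pastForm θ) := by
  unfold pastForm Finsupp.sum
  fun_prop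

theorem abs_pastForm_le (θ : ℕ →₀ Vec d) {R : ℝ} {z : PastSeq d} (hz : ∀ k, ‖z k‖ ≤ R) :
    |pastForm θ z| ≤ θ.sum fun _ u => ‖u‖ * R :=
  (Finset.abs_sum_le_sum_abs _ _).trans <| Finset.sum_le_sum fun k _ =>
    (abs_real_inner_le_norm _ _).trans (mul_le_mul_of_nonneg_left (hz k) (norm_nonneg _))

/-- `pastForm` as a bilinear pairing of sequences and finitely supported functionals. -/
def pastPairing (d : ℕ) : PastSeq d →ₗ[ℝ] (ℕ →₀ Vec d) →ₗ[ℝ] ℝ :=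
  LinearMap.mk₂ ℝ (fun z θ => pastForm θ z)
    (fun z z' θ => by simp [pastForm, Finsupp.sum, inner_add_right, Finset.sum_add_distrib])
    (fun a z θ => by simp [pastForm, Finsupp.sum, inner_smul_right, Finset.mul_sum])
    (fun z θ θ' => Finsupp.sum_add_index' (by simp) (by simp [inner_add_left]))
    (fun a z θ => by
      unfold pastForm
      rw [Finsupp.sum_smul_index' (by simp)]
      simp [Finsupp.sum, inner_smul_left, Finset.mul_sum])

theorem pastPairing_apply (z : PastSeq d) (θ : ℕ →₀ Vec d) :
    pastPairing d z θ = pastForm θ z :=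
  rfl

theorem pastForm_smul (s : ℝ) (θ : ℕ →₀ Vec d) (z : PastSeq d) :
    pastForm (s • θ) z = s * pastForm θ z :=
  (pastPairing d z).map_smul s θ

theorem ext_of_integral_cexp_pastForm {μ ν : Measure (PastSeq d)} [IsFiniteMeasure μ]
    [IsFiniteMeasure ν]
    (h : ∀ θ : ℕ →₀ Vec d, ∫ z, Complex.exp (pastForm θ z * Complex.I) ∂μ =
      ∫ z, Complex.exp (pastForm θ z * Complex.I) ∂ν) : μ = ν := by
  let : TopologicalSpace (ℕ →₀ Vec d) := ⊥
  have : DiscreteTopology (ℕ →₀ Vec d) := ⟨rfl⟩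
  let := TopologicalSpace.upgradeIsCompletelyMetrizable (PastSeq d)
  refine ext_of_integral_char_eq (L := pastPairing d) Real.continuous_probChar
    Real.probChar_ne_one (fun v hv => ?_) ?_ fun θ => ?_
  · obtain ⟨k, hk⟩ := Function.ne_iff.1 hv
    refine DFunLike.ne_iff.2 ⟨Finsupp.single k (v k), ?_⟩
    simpa [pastPairing_apply, pastForm] using hk
  · exact continuous_prod_of_discrete_right.2 continuous_pastForm
  · simpa [BoundedContinuousFunction.char_apply, Real.probChar_apply, pastPairing_apply] using h θ

variable {I : Set (PastSeq d)} {γ : Measure I}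

theorem ae_eq_zero_of_integral_cexp_pastForm_mul_eq_zero {φ : I → ℝ} (hφ : Integrable φ γ)
    (h : ∀ θ : ℕ →₀ Vec d, ∫ z : I, Complex.exp (pastForm θ z * Complex.I) * φ z ∂γ = 0) :
    φ =ᵐ[γ] 0 := by
  have := isFiniteMeasure_withDensity_ofReal hφ.2
  have := isFiniteMeasure_withDensity_ofReal hφ.neg.2
  refine ae_eq_zero_of_withDensity_ofReal_eq hφ (measure_ext_of_map_subtype_val_eq
    (ext_of_integral_cexp_pastForm fun θ => ?_))
  have hcont : Continuous fun z => Complex.exp (pastForm θ z * Complex.I) := by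
    have := continuous_pastForm θ
    fun_prop
  rw [integral_map measurable_subtype_coe.aemeasurable hcont.aestronglyMeasurable,
    integral_map measurable_subtype_coe.aemeasurable hcont.aestronglyMeasurable, ← sub_eq_zero,
    ← h θ]
  exact integral_withDensity_ofReal_sub hφ
    (hcont.comp continuous_subtype_val).aestronglyMeasurable
    fun z => (Complex.norm_exp_ofReal_mul_I _).le

/-- A neuron that acts directly on the past inputs, with input weights and bias `q`; the reservoir
is to reproduce such neurons. -/
def pastNeuron (σ : ℝ → ℝ) (q : (ℕ →₀ Vec d) × ℝ) (z : PastSeq d) : ℝ :=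
  σ (pastForm q.1 z + q.2)

variable {R : ℝ} {σ : ℝ → ℝ}

theorem memLp_pastNeuron [IsFiniteMeasure γ] (hR : ∀ z ∈ I, ∀ k, ‖z k‖ ≤ R) (hσ : Continuous σ)
    (q : (ℕ →₀ Vec d) × ℝ) (p : ℝ≥0∞) : MemLp (fun z : I => pastNeuron σ q z) p γ := by
  obtain ⟨K, hK⟩ := exists_abs_comp_affine_le hσ (q.1.sum fun _ u => ‖u‖ * R) q.2 1
  have hcont : Continuous fun z : I => pastNeuron σ q z :=
    hσ.comp (((continuous_pastForm q.1).comp continuous_subtype_val).add_const _)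
  refine MemLp.of_bound hcont.aestronglyMeasurable K (Eventually.of_forall fun z => ?_)
  simpa only [pastNeuron, Real.norm_eq_abs, one_mul] using
    hK 1 (Metric.mem_ball_self one_pos) _ (abs_pastForm_le q.1 (hR z z.2))

theorem exists_eLpNorm_sub_sum_pastNeuron_lt [IsFiniteMeasure γ] (hR : ∀ z ∈ I, ∀ k, ‖z k‖ ≤ R)
    {L : ℝ≥0} (hσ : LipschitzWith L σ) (hσ' : ¬ ∃ a b, ∀ x, σ x = a * x + b) {H : I → ℝ}
    (hH : MemLp H 2 γ) {e : ℝ≥0∞} (he : e ≠ 0) :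
    ∃ (n : ℕ) (q : Fin (n + 1) → (ℕ →₀ Vec d) × ℝ) (v : Fin (n + 1) → ℝ),
      eLpNorm (fun z : I => H z - ∑ j, v j * pastNeuron σ (q j) z) 2 γ < e := by
  refine exists_eLpNorm_sub_sum_lt_of_total
    (fun q => memLp_pastNeuron hR hσ.continuous q 2) (fun φ hφ horth => ?_) hH he
  have hφ_int : Integrable φ γ := hφ.integrable one_le_two
  refine ae_eq_zero_of_integral_cexp_pastForm_mul_eq_zero hφ_int fun θ => ?_
  refine integral_cexp_mul_eq_zero hφ_int
    ((continuous_pastForm θ).comp continuous_subtype_val).aestronglyMeasurable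
    (Eventually.of_forall fun z => abs_pastForm_le θ (hR z z.2)) hσ hσ' fun s b => ?_
  simpa only [pastNeuron, pastForm_smul] using horth (s • θ, b)

end PastNeurons

section AffineRecursion

variable {E : Type*} [NormedAddCommGroup E] [NormedSpace ℝ E] {T : E →L[ℝ] E} {l : ℝ}

theorem norm_pow_apply_le (hT : ‖T‖ ≤ l) (n : ℕ) {v : E} {r : ℝ} (hv : ‖v‖ ≤ r) :
    ‖(T ^ n) v‖ ≤ l ^ n * r := by
  have hl : 0 ≤ l := (norm_nonneg T).trans hT
  induction n with
  | zero => simpa using hv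
  | succ n ih =>
    rw [pow_succ', mul_apply_eq_comp, pow_succ', mul_assoc]
    exact (T.le_of_opNorm_le hT _).trans (mul_le_mul_of_nonneg_left ih hl)

variable {f x : ℕ → E}

theorem eq_sum_add_pow_of_recursion (hx : ∀ k, x k = T (x (k + 1)) + f k) (n k : ℕ) :
    x k = ∑ j ∈ Finset.range n, (T ^ j) (f (k + j)) + (T ^ n) (x (k + n)) := by
  induction n with
  | zero => simp
  | succ n ih =>
    rw [Finset.sum_range_succ, add_assoc, pow_succ, mul_apply_eq_comp, ← map_add,
      add_comm (f _), ← add_assoc k n 1, ← hx]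
    exact ih

variable {r : ℝ}

theorem norm_tsum_pow_apply_le (hT : ‖T‖ ≤ l) (hl : l < 1) (hf : ∀ k, ‖f k‖ ≤ r) (k : ℕ) :
    ‖∑' j, (T ^ j) (f (k + j))‖ ≤ (1 - l)⁻¹ * r :=
  tsum_of_norm_bounded ((hasSum_geometric_of_lt_one ((norm_nonneg T).trans hT) hl).mul_right r)
    fun j => norm_pow_apply_le hT j (hf _)

variable [CompleteSpace E]

theorem summable_pow_apply (hT : ‖T‖ ≤ l) (hl : l < 1) (hf : ∀ k, ‖f k‖ ≤ r) (k : ℕ) :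
    Summable fun j => (T ^ j) (f (k + j)) :=
  .of_norm_bounded ((summable_geometric_of_lt_one ((norm_nonneg T).trans hT) hl).mul_right r)
    fun j => norm_pow_apply_le hT j (hf _)

theorem tsum_pow_apply_recursion (hT : ‖T‖ ≤ l) (hl : l < 1) (hf : ∀ k, ‖f k‖ ≤ r) (k : ℕ) :
    ∑' j, (T ^ j) (f (k + j)) = T (∑' j, (T ^ j) (f (k + 1 + j))) + f k := by
  rw [(summable_pow_apply hT hl hf k).tsum_eq_zero_add,
    T.map_tsum (summable_pow_apply hT hl hf (k + 1)), add_comm]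
  congr 1
  refine tsum_congr fun j => ?_
  rw [pow_succ', mul_apply_eq_comp, add_assoc k 1 j, add_comm 1 j]

theorem eq_tsum_of_recursion (hT : ‖T‖ ≤ l) (hl : l < 1) (hf : ∀ k, ‖f k‖ ≤ r)
    (hx : ∀ k, x k = T (x (k + 1)) + f k) {M : ℝ} (hM : ∀ k, ‖x k‖ ≤ M) (k : ℕ) :
    x k = ∑' j, (T ^ j) (f (k + j)) := by
  have hl0 : 0 ≤ l := (norm_nonneg T).trans hT
  have hremainder : Tendsto (fun n => (T ^ n) (x (k + n))) atTop (𝓝 0) := by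
    refine squeeze_zero_norm (fun n => norm_pow_apply_le hT n (hM _)) ?_
    simpa using (tendsto_pow_atTop_nhds_zero_of_lt_one hl0 hl).mul_const M
  have hlim := (summable_pow_apply hT hl hf k).hasSum.tendsto_sum_nat.add hremainder
  simp_rw [← eq_sum_add_pow_of_recursion hx, add_zero] at hlim
  exact tendsto_nhds_unique tendsto_const_nhds hlim

theorem existsUnique_bounded_of_recursion (hT : ‖T‖ ≤ l) (hl : l < 1) (hf : ∀ k, ‖f k‖ ≤ r) :
    ∃! x : ℕ → E, (∀ k, x k = T (x (k + 1)) + f k) ∧ ∃ M, ∀ k, ‖x k‖ ≤ M :=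
  ⟨fun k => ∑' j, (T ^ j) (f (k + j)),
    ⟨tsum_pow_apply_recursion hT hl hf, _, norm_tsum_pow_apply_le hT hl hf⟩,
    fun _ ⟨hx, _, hM⟩ => funext (eq_tsum_of_recursion hT hl hf hx hM)⟩

end AffineRecursion

section State

variable {N d : ℕ} {A : Matrix (Fin N) (Fin N) ℝ} {B : Vec N} {C : Matrix (Fin N) (Fin d) ℝ}
  {z : PastSeq d} {c l R : ℝ}

/-- The inhomogeneity `C z_t + B` of the state equation. -/
def inputTerm (B : Vec N) (C : Matrix (Fin N) (Fin d) ℝ) (z : PastSeq d) (k : ℕ) : Vec N :=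
  WithLp.toLp 2 (C.mulVec (z k)) + B

theorem norm_inputTerm_le (hB : ‖B‖ ≤ c) (hC : ‖C‖ ≤ c) (hz : ∀ k, ‖z k‖ ≤ R) (k : ℕ) :
    ‖inputTerm B C z k‖ ≤ c * R + c :=
  (norm_add_le _ _).trans <| add_le_add ((Matrix.l2_opNorm_mulVec C (z k)).trans
    (mul_le_mul hC (hz k) (norm_nonneg _) ((norm_nonneg _).trans hC))) hB

theorem isBoundedSolution_id_iff {x : PastSeq N} :
    IsBoundedSolution id A B C z x ↔
      (∀ k, x k = Matrix.toEuclideanCLM (𝕜 := ℝ) A (x (k + 1)) + inputTerm B C z k) ∧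
        ∃ M, ∀ k, ‖x k‖ ≤ M := by
  refine and_congr_left fun _ => forall_congr' fun k => ?_
  rw [PiLp.ext_iff]
  simp [inputTerm, add_assoc]

theorem existsUnique_isBoundedSolution (hA : ‖A‖ < 1) (hz : ∀ k, ‖z k‖ ≤ R) :
    ∃! x, IsBoundedSolution id A B C z x := by
  simp_rw [isBoundedSolution_id_iff]
  exact existsUnique_bounded_of_recursion A.l2_opNorm_toEuclideanCLM.le hA
    (norm_inputTerm_le (le_max_left ‖B‖ ‖C‖) (le_max_right _ _) hz)

theorem isBoundedSolution_state (hA : ‖A‖ < 1) (hz : ∀ k, ‖z k‖ ≤ R) :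
    IsBoundedSolution id A B C z (state id A B C z) :=
  Classical.epsilon_spec (existsUnique_isBoundedSolution hA hz).exists

theorem state_recursion (hA : ‖A‖ < 1) (hz : ∀ k, ‖z k‖ ≤ R) (k : ℕ) :
    state id A B C z k = Matrix.toEuclideanCLM (𝕜 := ℝ) A (state id A B C z (k + 1)) +
      inputTerm B C z k :=
  (isBoundedSolution_id_iff.1 (isBoundedSolution_state hA hz)).1 k

theorem norm_state_le (hA : ‖A‖ ≤ l) (hl : l < 1) (hB : ‖B‖ ≤ c) (hC : ‖C‖ ≤ c)
    (hz : ∀ k, ‖z k‖ ≤ R) (k : ℕ) : ‖state id A B C z k‖ ≤ (1 - l)⁻¹ * (c * R + c) := by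
  have hT : ‖Matrix.toEuclideanCLM (𝕜 := ℝ) A‖ ≤ l := A.l2_opNorm_toEuclideanCLM.trans_le hA
  have hf := norm_inputTerm_le hB hC hz
  obtain ⟨hx, M, hM⟩ := isBoundedSolution_id_iff.1
    (isBoundedSolution_state (B := B) (C := C) (hA.trans_lt hl) hz)
  rw [eq_tsum_of_recursion hT hl hf hx hM]
  exact norm_tsum_pow_apply_le hT hl hf k

end State

section Controllability

variable {N d : ℕ}

theorem pastForm_eq_sum_range {θ : ℕ →₀ Vec d} {n : ℕ} (hθ : ∀ j, n ≤ j → θ (j + 1) = 0)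
    (z : PastSeq d) :
    pastForm θ z =
      ∑ j ∈ Finset.range n, inner ℝ (θ (j + 1)) (z (1 + j)) + inner ℝ (θ 0) (z 0) := by
  have hsub : θ.support ⊆ Finset.range (n + 1) := fun k hk => by
    rw [Finset.mem_range]
    by_contra! hnk
    obtain ⟨j, rfl⟩ := Nat.exists_eq_add_of_lt hnk
    exact Finsupp.mem_support_iff.1 hk (hθ (n + j) (Nat.le_add_right n j))
  rw [pastForm, Finsupp.sum_of_support_subset _ hsub _ (by simp),
    Finset.sum_range_succ']
  simp_rw [add_comm 1]

theorem exists_norm_toLp_le_of_hasFiniteSupport {s : ℕ → ℝ} (hs : s.HasFiniteSupport) :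
    ∃ S, ∀ N : ℕ, ‖(WithLp.toLp 2 fun m : Fin N => s m : Vec N)‖ ≤ S := by
  have hsum : Summable fun m => s m ^ 2 :=
    summable_of_hasFiniteSupport (hs.subset fun m hm h0 => hm (by simp [h0]))
  refine ⟨√(∑' m, s m ^ 2), fun N => ?_⟩
  rw [EuclideanSpace.norm_eq]
  simp only [Real.norm_eq_abs, sq_abs]
  rw [Fin.sum_univ_eq_sum_range (fun m => s m ^ 2) N]
  exact Real.sqrt_le_sqrt (hsum.sum_le_tsum _ fun _ _ => sq_nonneg _)

variable [NeZero d]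

/-- The coefficients of `z_{-1}, z_{-2}, …` in `pastForm θ`, stacked into one sequence and weighted
by `l^{-k}` in block `k`. -/
def stackedCoeff (θ : ℕ →₀ Vec d) (l : ℝ) (m : ℕ) : ℝ :=
  (l ^ (m / d))⁻¹ * θ (m / d + 1) (Fin.ofNat d m)

theorem hasFiniteSupport_stackedCoeff (θ : ℕ →₀ Vec d) (l : ℝ) :
    (stackedCoeff θ l).HasFiniteSupport := by
  have hblock : Tendsto (fun m => m / d + 1) cofinite cofinite := by
    rw [Nat.cofinite_eq_atTop]
    exact (tendsto_add_atTop_nat 1).comp (Nat.tendsto_div_const_atTop (NeZero.ne d))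
  have hθ : ∀ᶠ k in cofinite, θ k = 0 := θ.hasFiniteSupport
  refine (hblock.eventually hθ).mono fun m hm => ?_
  simp [stackedCoeff, hm]

/-- The assumptions on the parameters of an echo state network with `N` neurons. -/
structure IsAdmissible (A : Matrix (Fin N) (Fin N) ℝ) (B : Vec N) (C : Matrix (Fin N) (Fin d) ℝ)
    (c l₀ l₁ : ℝ) : Prop where
  isUnit_controllability : IsUnit (controllability A C)
  norm_reservoir_le : ‖A‖ ≤ l₁
  norm_bias_le : ‖B‖ ≤ c
  norm_mask_le : ‖C‖ ≤ c
  norm_inv_controllability_le : ‖(controllability A C)⁻¹.transpose * decay N d l₀‖ ≤ c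

variable {A : Matrix (Fin N) (Fin N) ℝ} {B : Vec N} {C : Matrix (Fin N) (Fin d) ℝ}
  {c l₀ l₁ : ℝ} {θ : ℕ →₀ Vec d} {S : ℝ}

/-- The state weight that reads the functional `pastForm θ` off the state: the solution `α` of
`Kᵀ α = (θ₁, θ₂, …)`, where `K` is the controllability matrix, cut off after `N` coordinates. It is
written as `K⁻ᵀ Λ (Λ⁻¹ (θ₁, θ₂, …))` because only `K⁻ᵀ Λ` is bounded uniformly in `N`. -/
def readoutWeight (A : Matrix (Fin N) (Fin N) ℝ) (C : Matrix (Fin N) (Fin d) ℝ)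
    (l : ℝ) (θ : ℕ →₀ Vec d) : Vec N :=
  WithLp.toLp 2 (((controllability A C)⁻¹.transpose * decay N d l).mulVec
    fun m : Fin N => stackedCoeff θ l m)

theorem norm_readoutWeight_le (h : IsAdmissible A B C c l₀ l₁)
    (hS : ‖(WithLp.toLp 2 fun m : Fin N => stackedCoeff θ l₀ m : Vec N)‖ ≤ S) :
    ‖readoutWeight A C l₀ θ‖ ≤ c * S := by
  have hc : 0 ≤ c := (norm_nonneg B).trans h.norm_bias_le
  unfold readoutWeight
  exact (Matrix.l2_opNorm_mulVec _ (WithLp.toLp 2 fun m : Fin N => stackedCoeff θ l₀ m)).trans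
    (mul_le_mul h.norm_inv_controllability_le hS (norm_nonneg _) hc)

theorem readoutWeight_vecMul_controllability (hK : IsUnit (controllability A C)) (hl₀ : l₀ ≠ 0)
    (θ : ℕ →₀ Vec d) (m : Fin N) :
    Matrix.vecMul (readoutWeight A C l₀ θ) (controllability A C) m =
      θ ((m : ℕ) / d + 1) (Fin.ofNat d m) := by
  have hdet : IsUnit (controllability A C).det := (Matrix.isUnit_iff_isUnit_det _).1 hK
  rw [← Matrix.mulVec_transpose, readoutWeight, Matrix.mulVec_mulVec, ← mul_assoc,
    ← Matrix.transpose_mul, Matrix.nonsing_inv_mul _ hdet, Matrix.transpose_one, one_mul, decay,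
    Matrix.mulVec_diagonal, stackedCoeff, mul_inv_cancel_left₀ (pow_ne_zero _ hl₀)]

theorem inner_readoutWeight (hK : IsUnit (controllability A C)) (hl₀ : l₀ ≠ 0)
    (θ : ℕ →₀ Vec d) {j : ℕ} (hj : j < N / d) (v : Vec d) :
    inner ℝ (readoutWeight A C l₀ θ)
      ((Matrix.toEuclideanCLM (𝕜 := ℝ) A ^ j) (WithLp.toLp 2 (C.mulVec v))) =
        inner ℝ (θ (j + 1)) v := by
  have hd : 0 < d := NeZero.pos d
  have hcolumn (i : Fin d) : Matrix.vecMul (readoutWeight A C l₀ θ) (A ^ j * C) i =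
      θ (j + 1) i := by
    have hm : d * j + i < N :=
      calc d * j + i < d * (j + 1) := Nat.add_lt_add_left i.2 _
        _ ≤ N := (Nat.mul_le_mul_left d hj).trans (Nat.mul_div_le N d)
    have hdiv : (d * j + i) / d = j := by
      rw [Nat.mul_add_div hd, Nat.div_eq_of_lt i.2, add_zero]
    have hmod : Fin.ofNat d (d * j + i) = i :=
      Fin.ext ((Nat.mul_add_mod d j i).trans (Nat.mod_eq_of_lt i.2))
    have h := readoutWeight_vecMul_controllability hK hl₀ θ ⟨d * j + i, hm⟩
    simpa only [Matrix.vecMul, dotProduct, controllability, Matrix.of_apply, hdiv, hmod] using h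
  rw [← map_pow, Matrix.toEuclideanCLM_toLp, Matrix.mulVec_mulVec, real_inner_comm,
    EuclideanSpace.inner_eq_star_dotProduct, real_inner_comm,
    EuclideanSpace.inner_eq_star_dotProduct, star_trivial, star_trivial,
    Matrix.dotProduct_mulVec]
  rw [funext hcolumn]

/-- The bias that cancels the contribution of `B` to the part of the state read by
`readoutWeight`. -/
def readoutOffset (A : Matrix (Fin N) (Fin N) ℝ) (B : Vec N) (C : Matrix (Fin N) (Fin d) ℝ)
    (l : ℝ) (θ : ℕ →₀ Vec d) : ℝ :=
  -∑ j ∈ Finset.range (N / d),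
    inner ℝ (readoutWeight A C l θ) ((Matrix.toEuclideanCLM (𝕜 := ℝ) A ^ j) B)

theorem abs_readoutOffset_le (h : IsAdmissible A B C c l₀ l₁) (hl₁ : l₁ < 1)
    (hS : ‖(WithLp.toLp 2 fun m : Fin N => stackedCoeff θ l₀ m : Vec N)‖ ≤ S) :
    |readoutOffset A B C l₀ θ| ≤ c * S * ((1 - l₁)⁻¹ * c) := by
  have hl0 : 0 ≤ l₁ := (norm_nonneg A).trans h.norm_reservoir_le
  have hc : 0 ≤ c := (norm_nonneg B).trans h.norm_bias_le
  have hA := A.l2_opNorm_toEuclideanCLM.trans_le h.norm_reservoir_le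
  rw [readoutOffset, abs_neg, ← inner_sum]
  refine (abs_real_inner_le_norm _ _).trans (mul_le_mul (norm_readoutWeight_le h hS) ?_
    (norm_nonneg _) ((norm_nonneg _).trans (norm_readoutWeight_le h hS)))
  calc ‖∑ j ∈ Finset.range (N / d), (Matrix.toEuclideanCLM (𝕜 := ℝ) A ^ j) B‖
      ≤ ∑ j ∈ Finset.range (N / d), l₁ ^ j * c :=
        norm_sum_le_of_le _ fun j _ => norm_pow_apply_le hA j h.norm_bias_le
    _ = (∑ j ∈ Finset.range (N / d), l₁ ^ j) * c := (Finset.sum_mul _ _ _).symm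
    _ ≤ (1 - l₁)⁻¹ * c := by
      refine mul_le_mul_of_nonneg_right ?_ hc
      exact sum_le_hasSum _ (fun j _ => pow_nonneg hl0 j) (hasSum_geometric_of_lt_one hl0 hl₁)

theorem abs_inner_readoutWeight_state_sub_le (h : IsAdmissible A B C c l₀ l₁) (hl₀ : l₀ ≠ 0)
    (hl₁ : l₁ < 1) (hS : ‖(WithLp.toLp 2 fun m : Fin N => stackedCoeff θ l₀ m : Vec N)‖ ≤ S)
    (hθ : ∀ j, N / d ≤ j → θ (j + 1) = 0) {z : PastSeq d} {R : ℝ} (hz : ∀ k, ‖z k‖ ≤ R) :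
    |inner ℝ (readoutWeight A C l₀ θ) (state id A B C z 1) + inner ℝ (θ 0) (z 0) +
      readoutOffset A B C l₀ θ - pastForm θ z| ≤
        c * S * (l₁ ^ (N / d) * ((1 - l₁)⁻¹ * (c * R + c))) := by
  have hA := A.l2_opNorm_toEuclideanCLM.trans_le h.norm_reservoir_le
  have hremainder : inner ℝ (readoutWeight A C l₀ θ) (state id A B C z 1) + inner ℝ (θ 0) (z 0) +
      readoutOffset A B C l₀ θ - pastForm θ z = inner ℝ (readoutWeight A C l₀ θ)
        ((Matrix.toEuclideanCLM (𝕜 := ℝ) A ^ (N / d)) (state id A B C z (1 + N / d))) := by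
    rw [eq_sum_add_pow_of_recursion (state_recursion (h.norm_reservoir_le.trans_lt hl₁) hz) (N / d),
      pastForm_eq_sum_range hθ, readoutOffset]
    simp only [inputTerm, inner_add_right, inner_sum, map_add, Finset.sum_add_distrib]
    rw [Finset.sum_congr rfl fun j hj => inner_readoutWeight h.isUnit_controllability hl₀ θ
      (Finset.mem_range.1 hj) (z (1 + j))]
    ring
  rw [hremainder]
  have hα := norm_readoutWeight_le h hS
  exact (abs_real_inner_le_norm _ _).trans (mul_le_mul hα (norm_pow_apply_le hA _
    (norm_state_le h.norm_reservoir_le hl₁ h.norm_bias_le h.norm_mask_le hz _)) (norm_nonneg _)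
    ((norm_nonneg _).trans hα))

end Controllability

section Wasserstein

variable {N d : ℕ}

theorem weightNorm_nonneg (x : Weights N d) : 0 ≤ weightNorm x := Real.sqrt_nonneg _

theorem weightNorm_le (x : Weights N d) :
    weightNorm x ≤ |x.1| + ‖x.2.1‖ + ‖x.2.2.1‖ + |x.2.2.2| := by
  have h₁ : 0 ≤ |x.1| * ‖x.2.1‖ := by positivity
  have h₂ : 0 ≤ (|x.1| + ‖x.2.1‖) * ‖x.2.2.1‖ := by positivity
  have h₃ : 0 ≤ (|x.1| + ‖x.2.1‖ + ‖x.2.2.1‖) * |x.2.2.2| := by positivity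
  refine Real.sqrt_le_iff.2 ⟨by positivity, ?_⟩
  rw [← sq_abs x.1, ← sq_abs x.2.2.2]
  linarith

/-- Hidden weights as an element of the `L²` product of normed spaces, whose norm is
`weightNorm`. -/
def toL2 (x : Weights N d) : WithLp 2 (ℝ × WithLp 2 (Vec N × WithLp 2 (Vec d × ℝ))) :=
  WithLp.toLp 2 (x.1, WithLp.toLp 2 (x.2.1, WithLp.toLp 2 x.2.2))

theorem norm_toL2 (x : Weights N d) : ‖toL2 x‖ = weightNorm x := by
  have hbc : ‖WithLp.toLp 2 x.2.2‖ ^ 2 = ‖x.2.2.1‖ ^ 2 + ‖x.2.2.2‖ ^ 2 :=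
    WithLp.prod_norm_sq_eq_of_L2 _
  have habc : ‖WithLp.toLp 2 (x.2.1, WithLp.toLp 2 x.2.2)‖ ^ 2 =
      ‖x.2.1‖ ^ 2 + ‖WithLp.toLp 2 x.2.2‖ ^ 2 := WithLp.prod_norm_sq_eq_of_L2 _
  simp only [toL2, weightNorm, WithLp.prod_norm_eq_of_L2 (WithLp.toLp 2 (x.1, _)),
    WithLp.toLp_fst, WithLp.toLp_snd, habc, hbc, Real.norm_eq_abs, sq_abs, add_assoc]

theorem weightNorm_sub_le (x y : Weights N d) :
    weightNorm (x - y) ≤ weightNorm x + weightNorm y := by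
  have hsub : toL2 (x - y) = toL2 x - toL2 y := rfl
  simpa only [← norm_toL2, hsub] using norm_sub_le (toL2 x) (toL2 y)

theorem measurable_weightNorm : Measurable (weightNorm : Weights N d → ℝ) := by
  unfold weightNorm
  fun_prop

theorem lintegral_weightNorm_sub_prod_le (ν μ : Measure (Weights N d)) [IsProbabilityMeasure ν]
    [IsProbabilityMeasure μ] :
    ∫⁻ p, ENNReal.ofReal (weightNorm (p.1 - p.2)) ∂ν.prod μ ≤ firstMoment ν + firstMoment μ := by
  have hw : Measurable fun x : Weights N d => ENNReal.ofReal (weightNorm x) :=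
    measurable_weightNorm.ennreal_ofReal
  have hw' : Measurable fun p : Weights N d × Weights N d => ENNReal.ofReal (weightNorm p.1) :=
    hw.comp measurable_fst
  calc ∫⁻ p, ENNReal.ofReal (weightNorm (p.1 - p.2)) ∂ν.prod μ
      ≤ ∫⁻ p, (ENNReal.ofReal (weightNorm p.1) + ENNReal.ofReal (weightNorm p.2)) ∂ν.prod μ :=
        lintegral_mono fun p => (ENNReal.ofReal_le_ofReal (weightNorm_sub_le _ _)).trans_eq
          (ENNReal.ofReal_add (weightNorm_nonneg _) (weightNorm_nonneg _))
    _ = firstMoment ν + firstMoment μ := by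
        rw [lintegral_add_left hw',
          measurePreserving_fst.lintegral_comp hw, measurePreserving_snd.lintegral_comp hw,
          firstMoment, firstMoment]

theorem isCoupling_diag_add_prod (ν μ : Measure (Weights N d)) [IsProbabilityMeasure ν]
    [IsProbabilityMeasure μ] {a b : ℝ≥0∞} (hab : a + b = 1) :
    IsCoupling (a • ν.map (fun x => (x, x)) + b • ν.prod μ) ν (a • ν + b • μ) := by
  have hdiag : Measurable fun x : Weights N d => (x, x) := by fun_prop
  constructor
  · rw [Measure.map_add _ _ measurable_fst, Measure.map_smul, Measure.map_smul,
      Measure.map_map measurable_fst hdiag, measurePreserving_fst.map_eq]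
    simp [Function.comp_def, ← add_smul, hab]
  · rw [Measure.map_add _ _ measurable_snd, Measure.map_smul, Measure.map_smul,
      Measure.map_map measurable_snd hdiag, measurePreserving_snd.map_eq]
    simp [Function.comp_def]

theorem wasserstein1_mixture_le (ν μ : Measure (Weights N d)) [IsProbabilityMeasure ν]
    [IsProbabilityMeasure μ] {a b : ℝ≥0∞} (hab : a + b = 1) :
    wasserstein1 ν (a • ν + b • μ) ≤ b * (firstMoment ν + firstMoment μ) := by
  have hdiag : Measurable fun x : Weights N d => (x, x) := by fun_prop
  have hcost : Measurable fun p : Weights N d × Weights N d =>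
      ENNReal.ofReal (weightNorm (p.1 - p.2)) :=
    (measurable_weightNorm.comp (measurable_fst.sub measurable_snd)).ennreal_ofReal
  refine (iInf₂_le (ι := Measure (Weights N d × Weights N d)) _
    (isCoupling_diag_add_prod ν μ hab)).trans ?_
  rw [lintegral_add_measure, lintegral_smul_measure, lintegral_smul_measure,
    lintegral_map hcost hdiag]
  have hzero (x : Weights N d) : ENNReal.ofReal (weightNorm (x - x)) = 0 := by simp [weightNorm]
  simp only [hzero, lintegral_zero, smul_zero, zero_add]
  exact mul_le_mul_right (lintegral_weightNorm_sub_prod_le ν μ) b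

end Wasserstein

section Sampling

variable {X ι κ : Type*}

/-- The event that the sample `ξ` contains every point of the family `p`. -/
def hitAll (p : ι → X) : Set (κ → X) := {ξ | ∀ j, ∃ i, ξ i = p j}

section Measurability

variable [MeasurableSpace X] [MeasurableSingletonClass X]

theorem measurableSet_coord_eq (i : κ) (x : X) : MeasurableSet {ξ : κ → X | ξ i = x} :=
  (measurable_pi_apply i : Measurable fun ξ : κ → X => ξ i) (measurableSet_singleton x)

theorem measurableSet_hitAll [Countable ι] [Countable κ] (p : ι → X) :
    MeasurableSet (hitAll p : Set (κ → X)) := by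
  simp only [hitAll, Set.ofPred_forall, Set.ofPred_exists]
  exact .iInter fun j => .iUnion fun i => measurableSet_coord_eq i (p j)

end Measurability

variable [Fintype ι] [Fintype κ]

open Classical in
/-- The readout that reproduces the combination `∑ j, v j • F (p j)` from the values of `F` at the
sample points: the coefficient `v j` is shared equally by the sample points equal to `p j`. It is
`0` unless the sample contains every `p j`. -/
def sampleReadout (p : ι → X) (v : ι → ℝ) : (κ → X) → κ → ℝ :=
  (hitAll p).indicator fun ξ i =>
    ∑ j, if ξ i = p j then v j / ∑ i', (if ξ i' = p j then 1 else 0) else 0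

theorem sum_sampleReadout_mul_of_mem {p : ι → X} {ξ : κ → X} (hξ : ξ ∈ hitAll p) (v : ι → ℝ)
    (F : X → ℝ) : ∑ i, sampleReadout p v ξ i * F (ξ i) = ∑ j, v j * F (p j) := by
  classical
  simp only [sampleReadout, Set.indicator_of_mem hξ, Finset.sum_mul]
  rw [Finset.sum_comm]
  refine Finset.sum_congr rfl fun j _ => ?_
  have hcount : (∑ i, if ξ i = p j then (1 : ℝ) else 0) ≠ 0 := by
    obtain ⟨i, hi⟩ := hξ j
    rw [Finset.sum_boole, Nat.cast_ne_zero, Finset.card_ne_zero]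
    exact ⟨i, by simpa using hi⟩
  calc ∑ i, (if ξ i = p j then v j / ∑ i', (if ξ i' = p j then 1 else 0) else 0) * F (ξ i)
      = ∑ i, (v j / ∑ i', if ξ i' = p j then 1 else 0) * F (p j) *
          (if ξ i = p j then 1 else 0) :=
        Finset.sum_congr rfl fun i _ => by split_ifs with h <;> simp [h]
    _ = v j * F (p j) := by
        rw [← Finset.mul_sum, mul_right_comm, div_mul_cancel₀ _ hcount]

theorem sampleReadout_of_notMem {p : ι → X} {ξ : κ → X} (hξ : ξ ∉ hitAll p) (v : ι → ℝ) :
    sampleReadout p v ξ = 0 :=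
  Set.indicator_of_notMem hξ _

variable [MeasurableSpace X]

/-- The uniform distribution on the points of a finite family, with multiplicities. -/
def empirical (p : ι → X) : Measure X :=
  ∑ j, (Fintype.card ι : ℝ≥0∞)⁻¹ • Measure.dirac (p j)

theorem card_mul_inv_card [Nonempty ι] :
    (Fintype.card ι : ℝ≥0∞) * (Fintype.card ι : ℝ≥0∞)⁻¹ = 1 :=
  ENNReal.mul_inv_cancel (by simp) (by simp)

instance [Nonempty ι] (p : ι → X) : IsProbabilityMeasure (empirical p) :=
  ⟨by simp [empirical, card_mul_inv_card]⟩

theorem lintegral_empirical_le [Nonempty ι] (p : ι → X) {g : X → ℝ≥0∞} (hg : Measurable g)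
    {K : ℝ≥0∞} (hK : ∀ j, g (p j) ≤ K) : ∫⁻ x, g x ∂empirical p ≤ K := by
  simp only [empirical, lintegral_finsetSum_measure, lintegral_smul_measure,
    lintegral_dirac' _ hg, smul_eq_mul]
  calc ∑ j, (Fintype.card ι : ℝ≥0∞)⁻¹ * g (p j)
      ≤ ∑ _j : ι, (Fintype.card ι : ℝ≥0∞)⁻¹ * K :=
        Finset.sum_le_sum fun j _ => mul_le_mul_right (hK j) _
    _ = K := by
        rw [Finset.sum_const, nsmul_eq_mul, ← mul_assoc, Finset.card_univ, card_mul_inv_card,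
          one_mul]

variable [MeasurableSingletonClass X]

theorem inv_card_le_empirical (p : ι → X) (j : ι) :
    (Fintype.card ι : ℝ≥0∞)⁻¹ ≤ empirical p {p j} := by
  rw [empirical, Measure.finsetSum_apply]
  calc (Fintype.card ι : ℝ≥0∞)⁻¹
      = ((Fintype.card ι : ℝ≥0∞)⁻¹ • Measure.dirac (p j)) {p j} := by simp
    _ ≤ _ := Finset.single_le_sum (f := fun k =>
        ((Fintype.card ι : ℝ≥0∞)⁻¹ • Measure.dirac (p k)) {p j}) (fun _ _ => zero_le)
        (Finset.mem_univ j)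

theorem measurable_sampleReadout (p : ι → X) (v : ι → ℝ) :
    Measurable (sampleReadout p v : (κ → X) → κ → ℝ) := by
  classical
  refine Measurable.indicator (measurable_pi_lambda _ fun i => ?_) (measurableSet_hitAll p)
  refine Finset.measurable_sum _ fun j _ => ?_
  refine Measurable.ite (measurableSet_coord_eq i (p j)) ?_ measurable_const
  refine measurable_const.div (Finset.measurable_sum _ fun i' _ => ?_)
  exact Measurable.ite (measurableSet_coord_eq i' (p j)) measurable_const measurable_const

variable {ν : Measure X} [IsProbabilityMeasure ν] {p : ι → X} {b : ℝ≥0∞}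

theorem pi_compl_hitAll_le (hb : ∀ j, b ≤ ν {p j}) :
    Measure.pi (fun _ : κ => ν) (hitAll p)ᶜ ≤
      Fintype.card ι * (1 - b) ^ Fintype.card κ := by
  have hmiss : (hitAll p : Set (κ → X))ᶜ ⊆ ⋃ j, Set.univ.pi fun _ : κ => {p j}ᶜ := by
    intro ξ hξ
    simpa [hitAll, Set.mem_pi] using hξ
  calc Measure.pi (fun _ : κ => ν) (hitAll p)ᶜ
      ≤ ∑ j, Measure.pi (fun _ : κ => ν) (Set.univ.pi fun _ : κ => {p j}ᶜ) :=
        (measure_mono hmiss).trans (measure_iUnion_fintype_le _ _)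
    _ ≤ ∑ _j : ι, (1 - b) ^ Fintype.card κ := by
        refine Finset.sum_le_sum fun j _ => ?_
        rw [Measure.pi_pi, Finset.prod_const, Finset.card_univ,
          prob_compl_eq_one_sub (measurableSet_singleton _)]
        exact pow_le_pow_left' (tsub_le_tsub_left (hb j) 1) _
    _ = Fintype.card ι * (1 - b) ^ Fintype.card κ := by simp

theorem lintegral_enorm_sub_sum_sampleReadout_le (hb : ∀ j, b ≤ ν {p j}) (v : ι → ℝ)
    (F : X → ℝ) (y : ℝ) :
    ∫⁻ ξ, ‖y - ∑ i, sampleReadout p v ξ i * F (ξ i)‖ₑ ^ 2 ∂(Measure.pi fun _ : κ => ν) ≤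
      ‖y - ∑ j, v j * F (p j)‖ₑ ^ 2 +
        Fintype.card ι * (1 - b) ^ Fintype.card κ * ‖y‖ₑ ^ 2 := by
  have hpointwise (ξ : κ → X) : ‖y - ∑ i, sampleReadout p v ξ i * F (ξ i)‖ₑ ^ 2 ≤
      ‖y - ∑ j, v j * F (p j)‖ₑ ^ 2 + (hitAll p)ᶜ.indicator (fun _ => ‖y‖ₑ ^ 2) ξ := by
    by_cases hξ : ξ ∈ hitAll p
    · rw [sum_sampleReadout_mul_of_mem hξ]
      exact le_self_add
    · simp [sampleReadout_of_notMem hξ, hξ]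
  refine (lintegral_mono hpointwise).trans ?_
  rw [lintegral_add_left measurable_const,
    lintegral_indicator_const (measurableSet_hitAll p).compl, lintegral_const, measure_univ,
    mul_one, mul_comm (‖y‖ₑ ^ 2)]
  gcongr
  exact pi_compl_hitAll_le hb

theorem lintegral_sampleReadout_le {Z : Type*} [MeasurableSpace Z] {γ : Measure Z} {H : Z → ℝ}
    (hH : MemLp H 2 γ) (hb : ∀ j, b ≤ ν {p j}) (v : ι → ℝ) (F : Z → X → ℝ) :
    ∫⁻ z, ∫⁻ ξ, ‖H z - ∑ i, sampleReadout p v ξ i * F z (ξ i)‖ₑ ^ 2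
        ∂(Measure.pi fun _ : κ => ν) ∂γ ≤
      eLpNorm (fun z => H z - ∑ j, v j * F z (p j)) 2 γ ^ 2 +
        Fintype.card ι * (1 - b) ^ Fintype.card κ * eLpNorm H 2 γ ^ 2 := by
  have hsq (f : Z → ℝ) : eLpNorm f 2 γ ^ 2 = ∫⁻ z, ‖f z‖ₑ ^ 2 ∂γ := by
    simpa using eLpNorm_nnreal_pow_eq_lintegral (f := f) (μ := γ) (p := 2) two_ne_zero
  refine (lintegral_mono fun z =>
    lintegral_enorm_sub_sum_sampleReadout_le hb v (F z) (H z)).trans_eq ?_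
  have hH' : AEMeasurable (fun z => ‖H z‖ₑ ^ 2) γ := hH.1.enorm.pow_const 2
  rw [lintegral_add_right' _ (hH'.const_mul _), lintegral_const_mul'' _ hH', hsq, hsq]

end Sampling

section Approximation

/-- A hidden neuron of the ESN-ELM, with hidden weights `x`. -/
def neuron {N d : ℕ} (σ : ℝ → ℝ) (A : Matrix (Fin N) (Fin N) ℝ) (B : Vec N)
    (C : Matrix (Fin N) (Fin d) ℝ) (x : Weights N d) (z : PastSeq d) : ℝ :=
  σ (inner ℝ x.2.1 (state id A B C z 1) + inner ℝ x.2.2.1 (z 0) + x.2.2.2)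

variable {d : ℕ} [NeZero d] {c l₀ l₁ R : ℝ} {σ : ℝ → ℝ} {L : ℝ≥0}

section FixedReservoir

variable {N : ℕ} {A : Matrix (Fin N) (Fin N) ℝ} {B : Vec N} {C : Matrix (Fin N) (Fin d) ℝ}
  {q : (ℕ →₀ Vec d) × ℝ} {S : ℝ}

/-- The hidden weights of the neuron that imitates `pastNeuron σ q`. -/
def imitatingWeights (A : Matrix (Fin N) (Fin N) ℝ) (B : Vec N) (C : Matrix (Fin N) (Fin d) ℝ)
    (l : ℝ) (q : (ℕ →₀ Vec d) × ℝ) : Weights N d :=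
  (0, readoutWeight A C l q.1, q.1 0, q.2 + readoutOffset A B C l q.1)

theorem weightNorm_imitatingWeights_le (h : IsAdmissible A B C c l₀ l₁) (hl₁ : l₁ < 1)
    (hS : ‖(WithLp.toLp 2 fun m : Fin N => stackedCoeff q.1 l₀ m : Vec N)‖ ≤ S) :
    weightNorm (imitatingWeights A B C l₀ q) ≤
      c * S + ‖q.1 0‖ + (|q.2| + c * S * ((1 - l₁)⁻¹ * c)) := by
  refine (weightNorm_le _).trans ?_
  have hα := norm_readoutWeight_le h hS
  have hβ := abs_readoutOffset_le h hl₁ hS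
  have hb := abs_add_le q.2 (readoutOffset A B C l₀ q.1)
  simp only [imitatingWeights, abs_zero, zero_add]
  linarith

theorem abs_neuron_imitatingWeights_sub_le (hσ : LipschitzWith L σ)
    (h : IsAdmissible A B C c l₀ l₁) (hl₀ : l₀ ≠ 0) (hl₁ : l₁ < 1)
    (hS : ‖(WithLp.toLp 2 fun m : Fin N => stackedCoeff q.1 l₀ m : Vec N)‖ ≤ S)
    (hq : ∀ j, N / d ≤ j → q.1 (j + 1) = 0) {z : PastSeq d} (hz : ∀ k, ‖z k‖ ≤ R) :
    |neuron σ A B C (imitatingWeights A B C l₀ q) z - pastNeuron σ q z| ≤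
      L * (c * S * (l₁ ^ (N / d) * ((1 - l₁)⁻¹ * (c * R + c)))) := by
  refine (hσ.dist_le_mul _ _).trans (mul_le_mul_of_nonneg_left ?_ L.2)
  rw [Real.dist_eq]
  refine (abs_inner_readoutWeight_state_sub_le h hl₀ hl₁ hS hq hz).trans_eq' (congrArg _ ?_)
  simp only [imitatingWeights]
  ring

end FixedReservoir

variable {A : (N : ℕ) → Matrix (Fin N) (Fin N) ℝ} {B : (N : ℕ) → Vec N}
  {C : (N : ℕ) → Matrix (Fin N) (Fin d) ℝ}

theorem exists_forall_eventually_abs_neuron_sub_le (hσ : LipschitzWith L σ)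
    (h : ∀ N, 1 ≤ N → IsAdmissible (A N) (B N) (C N) c l₀ l₁) (hl₀ : l₀ ≠ 0) (hl₁ : l₁ < 1)
    (R : ℝ) (q : (ℕ →₀ Vec d) × ℝ) :
    ∃ P : ℝ, ∀ η : ℝ, 0 < η → ∀ᶠ N in atTop, ∃ x : Weights N d, weightNorm x ≤ P ∧
      ∀ z : PastSeq d, (∀ k, ‖z k‖ ≤ R) →
        |neuron σ (A N) (B N) (C N) x z - pastNeuron σ q z| ≤ η := by
  obtain ⟨S, hS⟩ := exists_norm_toLp_le_of_hasFiniteSupport (hasFiniteSupport_stackedCoeff q.1 l₀)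
  refine ⟨c * S + ‖q.1 0‖ + (|q.2| + c * S * ((1 - l₁)⁻¹ * c)), fun η hη => ?_⟩
  have hl0 : 0 ≤ l₁ := (norm_nonneg (A 1)).trans (h 1 le_rfl).norm_reservoir_le
  have hblocks : Tendsto (fun N : ℕ => N / d) atTop atTop :=
    Nat.tendsto_div_const_atTop (NeZero.ne d)
  have herror : Tendsto (fun N : ℕ => L * (c * S * (l₁ ^ (N / d) * ((1 - l₁)⁻¹ * (c * R + c)))))
      atTop (𝓝 0) := by
    simpa using ((((tendsto_pow_atTop_nhds_zero_of_lt_one hl0 hl₁).comp hblocks).mul_const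
      ((1 - l₁)⁻¹ * (c * R + c))).const_mul (c * S)).const_mul (L : ℝ)
  have hvanish : ∀ᶠ n in atTop, ∀ j, n ≤ j → q.1 (j + 1) = 0 := by
    have hcofinite : ∀ᶠ k in atTop, q.1 k = 0 := by
      rw [← Nat.cofinite_eq_atTop]
      exact q.1.hasFiniteSupport
    exact eventually_forall_ge_atTop.2 ((tendsto_add_atTop_nat 1).eventually hcofinite)
  filter_upwards [hblocks.eventually hvanish, herror.eventually_le_const hη, eventually_ge_atTop 1]
    with N hqN hNη hN
  exact ⟨imitatingWeights (A N) (B N) (C N) l₀ q,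
    weightNorm_imitatingWeights_le (h N hN) hl₁ (hS N), fun z hz =>
      (abs_neuron_imitatingWeights_sub_le hσ (h N hN) hl₀ hl₁ (hS N) hqN hz).trans hNη⟩

theorem eLpNorm_le_add_const {α : Type*} [MeasurableSpace α] {μ : Measure α} {f g : α → ℝ}
    (hf : AEStronglyMeasurable f μ) {η : ℝ} (hη : 0 ≤ η)
    (h : ∀ x, |g x - f x| ≤ η) {p : ℝ≥0∞} (hp : 1 ≤ p) :
    eLpNorm g p μ ≤ eLpNorm f p μ + μ Set.univ ^ p.toReal⁻¹ * ENNReal.ofReal η := by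
  calc eLpNorm g p μ ≤ eLpNorm (fun x => ‖f x‖ + η) p μ := by
        refine eLpNorm_mono_real fun x => ?_
        have := abs_add_le (g x - f x) (f x)
        rw [sub_add_cancel] at this
        rw [Real.norm_eq_abs, Real.norm_eq_abs]
        linarith [h x]
    _ ≤ eLpNorm f p μ + eLpNorm (fun _ => η) p μ :=
        (eLpNorm_add_le hf.norm aestronglyMeasurable_const hp).trans_eq (by rw [eLpNorm_norm])
    _ ≤ eLpNorm f p μ + μ Set.univ ^ p.toReal⁻¹ * ENNReal.ofReal η := by
        gcongr
        exact eLpNorm_le_of_ae_bound (.of_forall fun _ => (Real.norm_of_nonneg hη).le)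

theorem exists_pos_add_mul_ofReal_lt {a e M : ℝ≥0∞} (hM : M ≠ ⊤) (hae : a < e) (V : ℝ) :
    ∃ η : ℝ, 0 < η ∧ a + M * ENNReal.ofReal (V * η) < e := by
  have hlim : Tendsto (fun η : ℝ => a + M * ENNReal.ofReal (V * η)) (𝓝[>] 0) (𝓝 a) := by
    have hV : Tendsto (fun η : ℝ => V * η) (𝓝[>] 0) (𝓝 (V * 0)) :=
      ((continuous_const_mul V).tendsto 0).mono_left nhdsWithin_le_nhds
    simpa using (ENNReal.Tendsto.const_mul (ENNReal.tendsto_ofReal hV) (Or.inr hM)).const_add a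
  exact (eventually_mem_nhdsWithin.and (hlim.eventually_lt_const hae)).exists

theorem exists_eventually_eLpNorm_sub_sum_neuron_lt (hσ : LipschitzWith L σ)
    (hσ' : ¬ ∃ a b, ∀ x, σ x = a * x + b)
    (h : ∀ N, 1 ≤ N → IsAdmissible (A N) (B N) (C N) c l₀ l₁) (hl₀ : l₀ ≠ 0) (hl₁ : l₁ < 1)
    {I : Set (PastSeq d)} (hR : ∀ z ∈ I, ∀ k, ‖z k‖ ≤ R) {γ : Measure I} [IsFiniteMeasure γ]
    {H : I → ℝ} (hH : MemLp H 2 γ) {e : ℝ≥0∞} (he : e ≠ 0) :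
    ∃ (n : ℕ) (v : Fin (n + 1) → ℝ) (P : ℝ), ∀ᶠ N in atTop, ∃ p : Fin (n + 1) → Weights N d,
      (∀ j, weightNorm (p j) ≤ P) ∧
        eLpNorm (fun z : I => H z - ∑ j, v j * neuron σ (A N) (B N) (C N) (p j) z) 2 γ < e := by
  obtain ⟨n, q, v, hqv⟩ := exists_eLpNorm_sub_sum_pastNeuron_lt hR hσ hσ' hH he
  choose P hP using fun j => exists_forall_eventually_abs_neuron_sub_le hσ h hl₀ hl₁ R (q j)
  obtain ⟨η, hη, hηe⟩ := exists_pos_add_mul_ofReal_lt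
    (ENNReal.rpow_ne_top_of_nonneg (inv_nonneg.2 ENNReal.toReal_nonneg)
      (measure_ne_top γ Set.univ)) hqv (∑ j, |v j|)
  refine ⟨n, v, ∑ j, |P j|, (eventually_all.2 fun j => hP j η hη).mono fun N hN => ?_⟩
  choose p hpP hp using hN
  refine ⟨p, fun j => (hpP j).trans ((le_abs_self _).trans
    (Finset.single_le_sum (f := fun j => |P j|) (fun _ _ => abs_nonneg _) (Finset.mem_univ j))),
    (eLpNorm_le_add_const ?_ (by positivity) (fun z => ?_) one_le_two).trans_lt hηe⟩
  · exact hH.1.sub (memLp_finsetSum _ fun j _ =>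
      (memLp_pastNeuron hR hσ.continuous (q j) 2).const_mul (v j)).1
  · rw [sub_sub_sub_cancel_left, abs_sub_comm, ← Finset.sum_sub_distrib, Finset.sum_mul]
    refine (Finset.abs_sum_le_sum_abs _ _).trans (Finset.sum_le_sum fun j _ => ?_)
    rw [← mul_sub, abs_mul]
    exact mul_le_mul_of_nonneg_left (hp j z (hR z z.2)) (abs_nonneg _)

end Approximation

section Perturbation

variable {N d : ℕ} {ι : Type*} [Fintype ι]

/-- The law `ν` with the fraction `δ` of its mass moved to the points of the family `p`. -/
def perturb (ν : Measure (Weights N d)) (δ : ℝ≥0∞) (p : ι → Weights N d) :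
    Measure (Weights N d) :=
  (1 - δ) • ν + δ • empirical p

theorem mul_inv_card_le_perturb {ν : Measure (Weights N d)} {δ : ℝ≥0∞} {p : ι → Weights N d}
    (j : ι) : δ * (Fintype.card ι : ℝ≥0∞)⁻¹ ≤ perturb ν δ p {p j} :=
  le_add_left (mul_le_mul_right (inv_card_le_empirical p j) δ)

variable [Nonempty ι] {ν : Measure (Weights N d)} [IsProbabilityMeasure ν] {δ : ℝ≥0∞}
  {p : ι → Weights N d}

theorem isProbabilityMeasure_perturb (hδ : δ ≤ 1) : IsProbabilityMeasure (perturb ν δ p) :=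
  ⟨by simp [perturb, tsub_add_cancel_of_le hδ]⟩

theorem wasserstein1_perturb_le (hδ : δ ≤ 1) {P : ℝ} (hp : ∀ j, weightNorm (p j) ≤ P) :
    wasserstein1 ν (perturb ν δ p) ≤ δ * (firstMoment ν + ENNReal.ofReal P) := by
  refine (wasserstein1_mixture_le ν _ (tsub_add_cancel_of_le hδ)).trans ?_
  gcongr
  exact lintegral_empirical_le p measurable_weightNorm.ennreal_ofReal fun j =>
    ENNReal.ofReal_le_ofReal (hp j)

end Perturbation

theorem exists_pos_le_one_mul_lt {M e : ℝ≥0∞} (hM : M ≠ ⊤) (he : e ≠ 0) :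
    ∃ δ : ℝ≥0∞, δ ≠ 0 ∧ δ ≤ 1 ∧ δ * M < e := by
  obtain ⟨δ, hδ, hδM⟩ := ENNReal.exists_nnreal_pos_mul_lt hM he
  refine ⟨min δ 1, by simp [hδ.ne'], min_le_right _ _, hδM.trans_le' ?_⟩
  exact mul_le_mul_left (min_le_left _ _) M

theorem eventually_sq_add_mul_one_sub_pow_lt {a e k b K : ℝ≥0∞} (hae : a < e) (hk : k ≠ ⊤)
    (hb : b ≠ 0) (hK : K ≠ ⊤) : ∀ᶠ N : ℕ in atTop, a ^ 2 + k * (1 - b) ^ N * K < e ^ 2 := by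
  have hpow : Tendsto (fun N : ℕ => (1 - b) ^ N) atTop (𝓝 0) :=
    ENNReal.tendsto_pow_atTop_nhds_zero_of_lt_one
      (ENNReal.sub_lt_self ENNReal.one_ne_top one_ne_zero hb)
  have hlim : Tendsto (fun N : ℕ => a ^ 2 + k * (1 - b) ^ N * K) atTop (𝓝 (a ^ 2)) := by
    simpa using (ENNReal.Tendsto.mul_const
      (ENNReal.Tendsto.const_mul hpow (Or.inr hk)) (Or.inr hK)).const_add (a ^ 2)
  exact hlim.eventually_lt_const (ENNReal.pow_lt_pow_left two_ne_zero hae)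

theorem not_affine_of_abs_le {σ : ℝ → ℝ} {K : ℝ} (hK : ∀ x, |σ x| ≤ K)
    (hne : ∃ x y, σ x ≠ σ y) : ¬ ∃ a b, ∀ x, σ x = a * x + b := by
  rintro ⟨a, b, h⟩
  have ha : a ≠ 0 := by
    rintro rfl
    obtain ⟨x, y, hxy⟩ := hne
    exact hxy (by rw [h x, h y, zero_mul, zero_mul])
  have hlarge := h ((K + 1 - b) / a)
  rw [mul_div_cancel₀ _ ha] at hlarge
  linarith [le_abs_self (σ ((K + 1 - b) / a)), hK ((K + 1 - b) / a)]

theorem exists_lipschitzWith_and_not_affine {σ : ℝ → ℝ}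
    (hσ : (σ = fun x => max x 0) ∨
      ((∃ K : ℝ, ∀ x, |σ x| ≤ K) ∧ (∃ L : ℝ≥0, LipschitzWith L σ) ∧ ∃ x y, σ x ≠ σ y)) :
    ∃ L : ℝ≥0, LipschitzWith L σ ∧ ¬ ∃ a b, ∀ x, σ x = a * x + b := by
  rcases hσ with rfl | ⟨⟨K, hK⟩, ⟨L, hL⟩, hne⟩
  · refine ⟨1, LipschitzWith.id.max_const 0, ?_⟩
    rintro ⟨a, b, h⟩
    have h₀ := h 0
    have h₁ := h 1
    have h₂ := h (-1)
    norm_num at h₀ h₁ h₂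
    linarith
  · exact ⟨L, hL, not_affine_of_abs_le hK hne⟩

end ESN

end

theorem mainTheorem3_general {d : ℕ} [NeZero d]
    (I : Set (ESN.PastSeq d)) (R : ℝ) (hR : ∀ z ∈ I, ∀ k, ‖z k‖ ≤ R)
    (σ₂ : ℝ → ℝ) (L : ℝ≥0) (hσ₂ : LipschitzWith L σ₂) (hσ₂' : ¬ ∃ a b, ∀ x, σ₂ x = a * x + b)
    (A : (N : ℕ) → Matrix (Fin N) (Fin N) ℝ)
    (B : (N : ℕ) → ESN.Vec N)
    (C : (N : ℕ) → Matrix (Fin N) (Fin d) ℝ)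
    (c l₀ l₁ : ℝ) (hl₀ : l₀ ≠ 0) (hl₁ : l₁ < 1)
    (hABC : ∀ N, 1 ≤ N → ESN.IsAdmissible (A N) (B N) (C N) c l₀ l₁)
    (ν₀ : (N : ℕ) → Measure (ESN.Weights N d)) [∀ N, IsProbabilityMeasure (ν₀ N)]
    (hν₀ : ∃ m : ℝ≥0, ∀ N, 1 ≤ N → ESN.firstMoment (ν₀ N) ≤ m)
    (H : I → ℝ) (γ : Measure I) [IsFiniteMeasure γ] (hH : MemLp H 2 γ)
    (ε : ℝ) (hε : 0 < ε) :
    ∃ N₀ : ℕ, ∀ N, N₀ ≤ N →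
      (∀ z ∈ I, ∃! x, ESN.IsBoundedSolution id (A N) (B N) (C N) z x) ∧
      ∃ ν : Measure (ESN.Weights N d), IsProbabilityMeasure ν ∧
        ESN.wasserstein1 (ν₀ N) ν < ENNReal.ofReal ε ∧
        ∃ W : (Fin N → ESN.Weights N d) → (Fin N → ℝ), Measurable W ∧
          (∫⁻ z, ∫⁻ ξ, ‖H z - ESN.esnElm id σ₂ (A N) (B N) (C N) (W ξ) ξ z‖ₑ ^ 2
            ∂(Measure.pi fun _ : Fin N => ν) ∂γ) ^ (1 / 2 : ℝ) < ENNReal.ofReal ε := by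
  obtain ⟨m, hm⟩ := hν₀
  have hε' : 0 < ENNReal.ofReal ε := ENNReal.ofReal_pos.2 hε
  obtain ⟨e, he, heε⟩ := exists_between hε'
  obtain ⟨n, v, P, hnetwork⟩ :=
    ESN.exists_eventually_eLpNorm_sub_sum_neuron_lt hσ₂ hσ₂' hABC hl₀ hl₁ hR hH he.ne'
  obtain ⟨δ, hδ0, hδ1, hδε⟩ := ESN.exists_pos_le_one_mul_lt
    (M := m + ENNReal.ofReal P) (by simp) hε'.ne'
  have hb : δ * (Fintype.card (Fin (n + 1)) : ℝ≥0∞)⁻¹ ≠ 0 := mul_ne_zero hδ0 (by simp)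
  refine Filter.eventually_atTop.1 ?_
  filter_upwards [hnetwork, ESN.eventually_sq_add_mul_one_sub_pow_lt heε
    (ENNReal.natCast_ne_top (Fintype.card (Fin (n + 1)))) hb (ENNReal.pow_ne_top hH.2.ne (n := 2)),
    Filter.eventually_ge_atTop 1] with N ⟨p, hpP, hpe⟩ hN hN1
  have hν := ESN.isProbabilityMeasure_perturb (ν := ν₀ N) (p := p) hδ1
  refine ⟨fun z hz => ESN.existsUnique_isBoundedSolution
    ((hABC N hN1).norm_reservoir_le.trans_lt hl₁) (hR z hz), ESN.perturb (ν₀ N) δ p, hν,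
    (ESN.wasserstein1_perturb_le hδ1 hpP).trans_lt (hδε.trans_le' ?_), ESN.sampleReadout p v,
    ESN.measurable_sampleReadout p v, ?_⟩
  · gcongr
    exact hm N hN1
  · have hmse := ESN.lintegral_sampleReadout_le (κ := Fin N) hH
      (ESN.mul_inv_card_le_perturb (ν := ν₀ N) (δ := δ) (p := p)) v
      fun z x => ESN.neuron σ₂ (A N) (B N) (C N) x z
    rw [one_div, ENNReal.rpow_inv_lt_iff two_pos, ENNReal.rpow_two]
    refine hmse.trans_lt (hN.trans_le' ?_)
    rw [Fintype.card_fin N]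
    gcongr

theorem mainTheorem3 {d : ℕ} [NeZero d]
    (D : Set (ESN.Vec d)) (hD : Bornology.IsBounded D)
    (I : Set (ESN.PastSeq d)) (hI : ∀ z ∈ I, ∀ k, z k ∈ D)
    (σ₂ : ℝ → ℝ)
    (hσ₂ : (σ₂ = fun x => max x 0) ∨
      ((∃ R : ℝ, ∀ x, |σ₂ x| ≤ R) ∧ (∃ L : ℝ≥0, LipschitzWith L σ₂) ∧ ∃ x y, σ₂ x ≠ σ₂ y))
    (A : (N : ℕ) → Matrix (Fin N) (Fin N) ℝ)
    (B : (N : ℕ) → ESN.Vec N)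
    (C : (N : ℕ) → Matrix (Fin N) (Fin d) ℝ)
    (c l₀ l₁ : ℝ) (hc : 0 < c) (hl₀ : 0 < l₀) (hl : l₀ < l₁) (hl₁ : l₁ < 1)
    (hK : ∀ N, 1 ≤ N → IsUnit (ESN.controllability (A N) (C N)))
    (hA : ∀ N, 1 ≤ N → l₀ < ‖A N‖ ∧ ‖A N‖ < l₁)
    (hB : ∀ N, 1 ≤ N → ‖B N‖ ≤ c)
    (hC : ∀ N, 1 ≤ N → ‖C N‖ ≤ c)
    (hKΛ : ∀ N, 1 ≤ N →
      ‖((ESN.controllability (A N) (C N))⁻¹).transpose * ESN.decay N d l₀‖ ≤ c)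
    (ν₀ : (N : ℕ) → Measure (ESN.Weights N d)) [∀ N, IsProbabilityMeasure (ν₀ N)]
    (hν₀ : ∃ m : ℝ≥0, ∀ N, 1 ≤ N → ESN.firstMoment (ν₀ N) ≤ m)
    (H : I → ℝ) (γ : Measure I) [IsProbabilityMeasure γ] (hH : MemLp H 2 γ)
    (ε : ℝ) (hε : 0 < ε) :
    ∃ N₀ : ℕ, ∀ N, N₀ ≤ N →
      (∀ z ∈ I, ∃! x, ESN.IsBoundedSolution id (A N) (B N) (C N) z x) ∧
      ∃ ν : Measure (ESN.Weights N d), IsProbabilityMeasure ν ∧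
        ESN.wasserstein1 (ν₀ N) ν < ENNReal.ofReal ε ∧
        ∃ W : (Fin N → ESN.Weights N d) → (Fin N → ℝ), Measurable W ∧
          (∫⁻ z, ∫⁻ ξ, ‖H z - ESN.esnElm id σ₂ (A N) (B N) (C N) (W ξ) ξ z‖ₑ ^ 2
            ∂(Measure.pi fun _ : Fin N => ν) ∂γ) ^ (1 / 2 : ℝ) < ENNReal.ofReal ε := by
  obtain ⟨R, hR⟩ := hD.exists_norm_le
  obtain ⟨L, hL, hσ⟩ := ESN.exists_lipschitzWith_and_not_affine hσ₂
  exact mainTheorem3_general I R (fun z hz k => hR _ (hI z hz k)) σ₂ L hL hσ A B C c l₀ l₁ hl₀.ne'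
    hl₁ (fun N hN => ⟨hK N hN, (hA N hN).2.le, hB N hN, hC N hN, hKΛ N hN⟩) ν₀ hν₀ H γ hH ε hε
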